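/- **Definitions.** An *order-unit space* is a real partially ordered vector space $A$ with a distinguished element $e\ge 0$ such that every $a\in A$ satisfies $a\le re$ for some $r\in\mathbb R$, and such that $a\le re$ for all $r>0$ implies $a\le 0$. It carries the norm $\|a\|=\inf\{r\ge 0:-re\le a\le re\}$. Its state space $S(A)$ is the set of bounded linear functionals $\mu$ with $\mu(e)=1=\|\mu\|$, with the weak-$*$ topology. A *Lip-norm* on $A$ is a seminorm $L$ with $L(a)=0\iff a\in\mathbb Re$ such that $\rho_L(\mu,\nu)=\sup\{|\mu(a)-\nu(a)|:L(a)\le 1\}$ defines the weak-$*$ topology on $S(A)$; then $(A,L)$ is called a *compact quantum metric space*. An isomorphism of order-unit spaces is a linear bijection which preserves the order in both directions and the unit. For compact quantum metric spaces $(A,L_A)$, $(B,L_B)$ let $\mathcal M(L_A,L_B)$ be the set of Lip-norms $L$ on $A\oplus B$ (componentwise order, unit $(e_A,e_B)$) with $L_A(a)=\inf_b L(a,b)$ and $L_B(b)=\inf_a L(a,b)$, and put $$\mathrm{dist}_q(A,B)=\inf\{\mathrm{dist}_H^{\rho_L}(S(A),S(B)) : L\in\mathcal M(L_A,L_B)\}\in[0,\infty],$$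 where $S(A),S(B)\subseteq S(A\oplus B)$ through the two projections and $\mathrm{dist}_H^{\rho_L}$ is the Hausdorff distance for $\rho_L$ (infinite if exactly one of the two sets is empty). Let $\bar A$ be the norm completion of $A$, with unit $e$ and with positive cone the closure of that of $A$. The *closure* $(A^c,L^c)$ of $(A,L)$ is the subspace $A^c$ of $\bar A$ spanned by the norm closure in $\bar A$ of $\{a\in A:L(a)\le 1\}$, with the gauge $L^c$ of that closed set. An *isometry* from $(A,L_A)$ to $(B,L_B)$ is an isomorphism $\varphi:A^c\to B^c$ of order-unit spaces with $L_B^c\circ\varphi=L_A^c$. Let $\mathcal Q$ be the space of isometry classes of compact quantum metric spaces, with the topology given by $\mathrm{dist}_q$. A compact metric space $(X,\rho)$ gives the compact quantum metric space $(C(X),L_\rho)$, by which is meant the order-unit space of real-valued Lipschitz functions on $X$, with the pointwise order and the unit $1$, together with $L_\rho(f)=\sup_{x\ne y}|f(x)-f(y)|/\rho(x,y)$. **Theorem.** The set of isometry classes of the spaces $(C(X),L_\rho)$, for $(X,\rho)$ an ordinary compact metric space, is a closed subset of $\mathcal Q$. Moreover, if $(X_n,\rho_n)$ is a sequence of compact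 metric spaces and $(A,L)$ is a compact quantum metric space with $\mathrm{dist}_q\big((C(X_n),L_{\rho_n}),(A,L)\big)\to 0$, then there are a compact metric space $(Y,\rho)$ and an isomorphism of order-unit spaces $\Phi:\bar A\to C(Y)$ onto the space of all continuous real-valued functions on $Y$, such that $\Phi$ carries $A^c$ onto the space of Lipschitz functions on $Y$ and $L^c(x)=L_\rho(\Phi(x))$ for all $x\in A^c$. -/

import Mathlib

open scoped ENNReal Topology

universe u v w

namespace QGH

set_option linter.unusedSectionVars false

/-! ## Order-unit spaces -/

/-- An order-unit space: a real partially ordered vector space with a distinguished positive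
element, written `1`, such that every element is dominated by a multiple of `1`, and which is
Archimedean. -/
class OrderUnitSpace (A : Type u) [AddCommGroup A] [PartialOrder A] [IsOrderedAddMonoid A]
    [Module ℝ A] [PosSMulMono ℝ A] [One A] : Prop where
  unit_nonneg : (0 : A) ≤ 1
  exists_le : ∀ a : A, ∃ r : ℝ, a ≤ r • (1 : A)
  archimedean : ∀ a : A, (∀ r : ℝ, 0 < r → a ≤ r • (1 : A)) → a ≤ 0

section OrderUnit

variable (A : Type u) [AddCommGroup A] [PartialOrder A] [IsOrderedAddMonoid A]
  [Module ℝ A] [PosSMulMono ℝ A] [One A] [OrderUnitSpace A]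

variable {A} in
/-- The set of those `r ≥ 0` with `-r e ≤ a ≤ r e`. (Unless `A` is the zero space, `r ≥ 0` is
automatic.) -/
def normSet (a : A) : Set ℝ := {r : ℝ | 0 ≤ r ∧ -(r • (1 : A)) ≤ a ∧ a ≤ r • (1 : A)}

variable {A} in
theorem smul_unit_mono {r s : ℝ} (h : r ≤ s) : r • (1 : A) ≤ s • (1 : A) := by
  have h1 : (0 : A) ≤ (s - r) • (1 : A) :=
    smul_nonneg (sub_nonneg.2 h) OrderUnitSpace.unit_nonneg
  rw [sub_smul] at h1
  exact sub_nonneg.1 h1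

variable {A} in
theorem normSet_nonempty (a : A) : (normSet a).Nonempty := by
  obtain ⟨r, hr⟩ := OrderUnitSpace.exists_le a
  obtain ⟨s, hs⟩ := OrderUnitSpace.exists_le (-a)
  refine ⟨max 0 (max r s), le_max_left _ _, ?_, ?_⟩
  · rw [neg_le]
    exact hs.trans (smul_unit_mono ((le_max_right _ _).trans (le_max_right _ _)))
  · exact hr.trans (smul_unit_mono ((le_max_left _ _).trans (le_max_right _ _)))

variable {A} in
theorem normSet_bddBelow (a : A) : BddBelow (normSet a) := ⟨0, fun _ h => h.1⟩

variable {A} in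
/-- The order-unit norm `‖a‖ = inf {r : -r e ≤ a ≤ r e}`. -/
noncomputable def ouNorm (a : A) : ℝ := sInf (normSet a)

variable {A} in
theorem ouNorm_nonneg (a : A) : 0 ≤ ouNorm a := Real.sInf_nonneg fun _ h => h.1

variable {A} in
theorem le_of_ouNorm_lt {a : A} {r : ℝ} (h : ouNorm a < r) :
    -(r • (1 : A)) ≤ a ∧ a ≤ r • (1 : A) := by
  obtain ⟨s, hs, hsr⟩ := exists_lt_of_csInf_lt (normSet_nonempty a) h
  exact ⟨(neg_le_neg (smul_unit_mono hsr.le)).trans hs.2.1, hs.2.2.trans (smul_unit_mono hsr.le)⟩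

variable {A} in
theorem ouNorm_le {a : A} {r : ℝ} (h0 : 0 ≤ r) (h1 : -(r • (1 : A)) ≤ a)
    (h2 : a ≤ r • (1 : A)) : ouNorm a ≤ r := csInf_le (normSet_bddBelow a) ⟨h0, h1, h2⟩

/-- The order-unit norm as a norm on the additive group. -/
noncomputable def ouGroupNorm : AddGroupNorm A where
  toFun := ouNorm
  map_zero' := le_antisymm (ouNorm_le le_rfl (by simp) (by simp)) (ouNorm_nonneg _)
  add_le' a b := by
    refine le_of_forall_pos_le_add fun ε hε => ?_
    obtain ⟨h1, h2⟩ := le_of_ouNorm_lt (show ouNorm a < ouNorm a + ε / 2 by linarith)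
    obtain ⟨h3, h4⟩ := le_of_ouNorm_lt (show ouNorm b < ouNorm b + ε / 2 by linarith)
    have e : ouNorm a + ouNorm b + ε = (ouNorm a + ε / 2) + (ouNorm b + ε / 2) := by ring
    refine ouNorm_le (by have := ouNorm_nonneg a; have := ouNorm_nonneg b; linarith) ?_ ?_
    · rw [e, add_smul, neg_add]; exact add_le_add h1 h3
    · rw [e, add_smul]; exact add_le_add h2 h4
  neg' a := by
    have : normSet (-a) = normSet a := by
      ext r
      constructor
      · rintro ⟨h, h1, h2⟩; exact ⟨h, neg_le.1 h2, neg_le_neg_iff.1 h1⟩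
      · rintro ⟨h, h1, h2⟩; exact ⟨h, neg_le_neg h2, neg_le.1 h1⟩
    simp only [ouNorm, this]
  eq_zero_of_map_eq_zero' a h := by
    have h' : ∀ r : ℝ, 0 < r → -(r • (1 : A)) ≤ a ∧ a ≤ r • (1 : A) :=
      fun r hr => le_of_ouNorm_lt (by rw [h]; exact hr)
    refine le_antisymm (OrderUnitSpace.archimedean a fun r hr => (h' r hr).2) ?_
    exact neg_nonpos.1 (OrderUnitSpace.archimedean (-a) fun r hr => neg_le.1 (h' r hr).1)

/-- A copy of the order-unit space `A`, carrying the order-unit norm. (A copy is used because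
`A` may already carry another norm, for instance when `A` is a product.) -/
def Normed (A : Type u) : Type u := A

/-- The identity map from `A` to its normed copy. -/
def toNormed {A : Type u} (a : A) : Normed A := a

noncomputable instance : NormedAddCommGroup (Normed A) := (ouGroupNorm A).toNormedAddCommGroup

instance : Module ℝ (Normed A) := inferInstanceAs (Module ℝ A)

instance : One (Normed A) := inferInstanceAs (One A)

variable {A} in
theorem ouNorm_smul_le_of_nonneg {c : ℝ} (hc : 0 ≤ c) (a : A) :
    ouNorm (c • a) ≤ c * ouNorm a := by
  refine le_of_forall_pos_le_add fun ε hε => ?_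
  set δ : ℝ := ε / (c + 1) with hδ
  have hc1 : 0 < c + 1 := by positivity
  have hδ0 : 0 < δ := div_pos hε hc1
  obtain ⟨h1, h2⟩ := le_of_ouNorm_lt (show ouNorm a < ouNorm a + δ by linarith)
  have hr : c * (ouNorm a + δ) ≤ c * ouNorm a + ε := by
    have : (c + 1) * δ = ε := by rw [hδ]; field_simp
    nlinarith
  refine (ouNorm_le (mul_nonneg hc (add_nonneg (ouNorm_nonneg _) hδ0.le)) ?_ ?_).trans hr
  · rw [mul_smul, ← smul_neg]; exact smul_le_smul_of_nonneg_left h1 hc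
  · rw [mul_smul]; exact smul_le_smul_of_nonneg_left h2 hc

noncomputable instance : NormedSpace ℝ (Normed A) where
  norm_smul_le c a := by
    rcases le_total 0 c with h | h
    · rw [Real.norm_eq_abs, abs_of_nonneg h]
      exact ouNorm_smul_le_of_nonneg (A := A) h a
    · rw [Real.norm_eq_abs, abs_of_nonpos h, ← norm_neg, ← neg_smul]
      exact ouNorm_smul_le_of_nonneg (A := A) (neg_nonneg.2 h) a

/-! ## States and Lip-norms -/

/-- The state space `S(A)`: the bounded linear functionals `μ` with `μ e = 1 = ‖μ‖`, with the
weak-* topology. -/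
abbrev State : Type u :=
  {μ : WeakDual ℝ (Normed A) // μ (toNormed 1) = 1 ∧ ‖WeakDual.toStrongDual μ‖ = 1}

variable {A}

/-- The value `μ a` of a state. -/
noncomputable def State.eval (μ : State A) (a : A) : ℝ := μ.1 (toNormed a)

/-- `ρ_L(μ, ν) = sup {|μ a - ν a| : L a ≤ 1}`, with values in `[0, ∞]`. -/
noncomputable def rho (L : Seminorm ℝ A) (μ ν : State A) : ℝ≥0∞ :=
  ⨆ (a : A) (_ : L a ≤ 1), ENNReal.ofReal |μ.eval a - ν.eval a|

/-- The state space as an extended (pseudo)metric space for `ρ_L`. -/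
noncomputable abbrev stateEMetric (L : Seminorm ℝ A) : PseudoEMetricSpace (State A) where
  edist := rho L
  edist_self μ := by simp [rho]
  edist_comm μ ν := by simp only [rho, abs_sub_comm]
  edist_triangle μ ν ξ := by
    refine iSup₂_le fun a ha => ?_
    have h1 : ENNReal.ofReal |μ.eval a - ν.eval a| ≤ rho L μ ν :=
      le_iSup₂ (f := fun (a : A) (_ : L a ≤ 1) => ENNReal.ofReal |μ.eval a - ν.eval a|) a ha
    have h2 : ENNReal.ofReal |ν.eval a - ξ.eval a| ≤ rho L ν ξ :=
      le_iSup₂ (f := fun (a : A) (_ : L a ≤ 1) => ENNReal.ofReal |ν.eval a - ξ.eval a|) a ha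
    refine le_trans ?_ (add_le_add h1 h2)
    rw [← ENNReal.ofReal_add (abs_nonneg _) (abs_nonneg _)]
    exact ENNReal.ofReal_le_ofReal (abs_sub_le _ _ _)

/-- A Lip-norm: a seminorm which vanishes exactly on the multiples of the unit and for which the
topology of `ρ_L` on the state space is the weak-* topology. -/
structure IsLipNorm (L : Seminorm ℝ A) : Prop where
  eq_zero_iff : ∀ a : A, L a = 0 ↔ ∃ r : ℝ, a = r • (1 : A)
  topology_eq : (stateEMetric L).toUniformSpace.toTopologicalSpace =
    (inferInstance : TopologicalSpace (State A))

theorem State.eval_add (μ : State A) (a b : A) : μ.eval (a + b) = μ.eval a + μ.eval b :=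
  map_add μ.1 (toNormed a) (toNormed b)

theorem State.eval_sub (μ : State A) (a b : A) : μ.eval (a - b) = μ.eval a - μ.eval b :=
  map_sub μ.1 (toNormed a) (toNormed b)

theorem State.eval_smul (μ : State A) (r : ℝ) (a : A) : μ.eval (r • a) = r * μ.eval a :=
  map_smul μ.1 r (toNormed a)

theorem State.eval_one (μ : State A) : μ.eval (1 : A) = 1 := μ.2.1

theorem State.abs_eval_le (μ : State A) (a : A) : |μ.eval a| ≤ ouNorm a := by
  have := (WeakDual.toStrongDual μ.1).le_opNorm (toNormed a)
  rw [μ.2.2, one_mul] at this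
  exact this

theorem State.continuous_eval (a : A) : Continuous fun μ : State A => μ.eval a :=
  (WeakDual.eval_continuous (toNormed a)).comp continuous_subtype_val

theorem State.abs_sub_le_rho (L : Seminorm ℝ A) (a : A) (μ ν : State A) :
    ENNReal.ofReal |μ.eval a - ν.eval a| ≤ ENNReal.ofReal (L a + 1) * rho L μ ν := by
  have hK : 0 < L a + 1 := by have := apply_nonneg L a; linarith
  have hb : L ((L a + 1)⁻¹ • a) ≤ 1 := by
    rw [map_smul_eq_mul, Real.norm_eq_abs, abs_of_pos (inv_pos.2 hK), inv_mul_le_iff₀ hK]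
    linarith
  have h1 : ENNReal.ofReal |μ.eval ((L a + 1)⁻¹ • a) - ν.eval ((L a + 1)⁻¹ • a)| ≤ rho L μ ν :=
    le_iSup₂ (f := fun (a : A) (_ : L a ≤ 1) => ENNReal.ofReal |μ.eval a - ν.eval a|) _ hb
  refine le_trans ?_ (mul_le_mul_right h1 _)
  rw [← ENNReal.ofReal_mul hK.le]
  refine ENNReal.ofReal_le_ofReal ?_
  rw [State.eval_smul, State.eval_smul, ← mul_sub, abs_mul, abs_of_pos (inv_pos.2 hK),
    mul_inv_cancel_left₀ hK.ne']

theorem State.isInducing_eval : Topology.IsInducing fun (μ : State A) (a : A) => μ.eval a :=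
  Topology.IsInducing.comp (g := fun (μ : WeakDual ℝ (Normed A)) (a : Normed A) => μ a) ⟨rfl⟩
    Topology.IsInducing.subtypeVal

theorem continuous_of_edist_bound {S : Type v} [PseudoEMetricSpace S] {ι : Type w}
    (f : S → ι → ℝ) (h : ∀ i, ∃ K : NNReal, ∀ x y,
      ENNReal.ofReal |f x i - f y i| ≤ K * edist x y) : Continuous f := by
  refine continuous_pi fun i => ?_
  obtain ⟨K, hK⟩ := h i
  have hL : LipschitzWith K fun x => f x i := by
    intro x y
    rw [edist_dist, Real.dist_eq]
    exact hK x y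
  exact hL.continuous

theorem continuous_of_eventually_edist_lt {S : Type v} [TopologicalSpace S] {T : Type w}
    [PseudoEMetricSpace T] (f : S → T)
    (h : ∀ x, ∀ ε : ℝ≥0∞, 0 < ε → ∀ᶠ y in 𝓝 x, edist (f y) (f x) < ε) : Continuous f :=
  continuous_iff_continuousAt.2 fun x => EMetric.tendsto_nhds.2 fun ε hε => h x ε hε

/-- A criterion for Lip-norms: the `L`-unit ball is totally bounded modulo the scalars. -/
theorem IsLipNorm.of_finite_net (L : Seminorm ℝ A)
    (h0 : ∀ a : A, L a = 0 ↔ ∃ r : ℝ, a = r • (1 : A))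
    (hnet : ∀ ε : ℝ, 0 < ε → ∃ F : Set A, F.Finite ∧ ∀ a : A, L a ≤ 1 →
      ∃ f ∈ F, ∃ c : ℝ, ouNorm (a - f - c • (1 : A)) ≤ ε) : IsLipNorm L := by
  refine ⟨h0, le_antisymm ?_ ?_⟩
  · rw [State.isInducing_eval.eq_induced, ← continuous_iff_le_induced]
    exact @continuous_of_edist_bound _ (stateEMetric L) _ _
      fun a => ⟨Real.toNNReal (L a + 1), State.abs_sub_le_rho L a⟩
  · rw [← continuous_id_iff_le]
    refine @continuous_of_eventually_edist_lt _ _ _ (stateEMetric L) _ fun μ ε hε => ?_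
    obtain ⟨δ, hδ0, hδ⟩ : ∃ δ : ℝ, 0 < δ ∧ ENNReal.ofReal (3 * δ) < ε := by
      rcases eq_or_ne ε ⊤ with rfl | htop
      · exact ⟨1, one_pos, ENNReal.ofReal_lt_top⟩
      · have hp : 0 < ε.toReal := ENNReal.toReal_pos hε.ne' htop
        refine ⟨ε.toReal / 4, by positivity, ?_⟩
        rw [ENNReal.ofReal_lt_iff_lt_toReal (by positivity) htop]
        linarith
    obtain ⟨F, hF, hFa⟩ := hnet δ hδ0
    have hev : ∀ᶠ ν : State A in 𝓝 μ,
        ∀ f ∈ F, |ν.eval f - μ.eval f| < δ := by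
      rw [Filter.eventually_all_finite hF]
      intro f _
      exact (State.continuous_eval f).continuousAt.eventually
        (Metric.ball_mem_nhds (μ.eval f) hδ0)
    refine hev.mono fun ν hν => lt_of_le_of_lt ?_ hδ
    refine iSup₂_le fun a ha => ENNReal.ofReal_le_ofReal ?_
    obtain ⟨f, hf, c, hc⟩ := hFa a ha
    have h1 := (abs_le.1 ((ν.abs_eval_le _).trans hc))
    have h2 := (abs_le.1 ((μ.abs_eval_le _).trans hc))
    have h3 := abs_lt.1 (hν f hf)
    simp only [State.eval_sub, State.eval_smul, State.eval_one] at h1 h2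
    simp only [id]
    rw [abs_le]
    constructor <;> linarith [h1.1, h1.2, h2.1, h2.2, h3.1, h3.2]

end OrderUnit

/-! ## Quantum Gromov-Hausdorff distance -/

/-- A compact quantum metric space: an order-unit space with a Lip-norm. -/
structure CQMS where
  carrier : Type u
  [addCommGroup : AddCommGroup carrier]
  [partialOrder : PartialOrder carrier]
  [isOrderedAddMonoid : IsOrderedAddMonoid carrier]
  [module : Module ℝ carrier]
  [posSMulMono : PosSMulMono ℝ carrier]
  [one : One carrier]
  [orderUnitSpace : OrderUnitSpace carrier]
  L : Seminorm ℝ carrier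
  isLipNorm : IsLipNorm L

attribute [instance] CQMS.addCommGroup CQMS.partialOrder CQMS.isOrderedAddMonoid CQMS.module
  CQMS.posSMulMono CQMS.one CQMS.orderUnitSpace

/-- The direct sum of order-unit spaces, with the componentwise order and the unit `(e, e)`. -/
instance (A : Type u) (B : Type v)
    [AddCommGroup A] [PartialOrder A] [IsOrderedAddMonoid A] [Module ℝ A] [PosSMulMono ℝ A]
    [One A] [OrderUnitSpace A]
    [AddCommGroup B] [PartialOrder B] [IsOrderedAddMonoid B] [Module ℝ B] [PosSMulMono ℝ B]
    [One B] [OrderUnitSpace B] : OrderUnitSpace (A × B) where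
  unit_nonneg := ⟨OrderUnitSpace.unit_nonneg, OrderUnitSpace.unit_nonneg⟩
  exists_le p := by
    obtain ⟨r, hr⟩ := OrderUnitSpace.exists_le p.1
    obtain ⟨s, hs⟩ := OrderUnitSpace.exists_le p.2
    exact ⟨max r s, hr.trans (smul_unit_mono (le_max_left _ _)),
      hs.trans (smul_unit_mono (le_max_right _ _))⟩
  archimedean p h := ⟨OrderUnitSpace.archimedean _ fun r hr => (h r hr).1,
    OrderUnitSpace.archimedean _ fun r hr => (h r hr).2⟩

/-- `S(A)` inside `S(A ⊕ B)`: the states that factor through the projection to `A`. -/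
def statesLeft (A : CQMS.{u}) (B : CQMS.{v}) : Set (State (A.carrier × B.carrier)) :=
  {σ | ∃ μ : State A.carrier, ∀ p, σ.eval p = μ.eval p.1}

/-- `S(B)` inside `S(A ⊕ B)`: the states that factor through the projection to `B`. -/
def statesRight (A : CQMS.{u}) (B : CQMS.{v}) : Set (State (A.carrier × B.carrier)) :=
  {σ | ∃ ν : State B.carrier, ∀ p, σ.eval p = ν.eval p.2}

/-- The set `M(L_A, L_B)` of Lip-norms on `A ⊕ B` whose quotient seminorms on `A` and `B` are
`L_A` and `L_B`. -/
def inducingLipNorms (A : CQMS.{u}) (B : CQMS.{v}) : Set (Seminorm ℝ (A.carrier × B.carrier)) :=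
  {L | IsLipNorm L ∧ (∀ a, A.L a = ⨅ b : B.carrier, L (a, b)) ∧
    ∀ b, B.L b = ⨅ a : A.carrier, L (a, b)}

/-- The quantum Gromov-Hausdorff distance: the infimum over `L ∈ M(L_A, L_B)` of the Hausdorff
distance of `S(A)` and `S(B)` for `ρ_L`. -/
noncomputable def distq (A : CQMS.{u}) (B : CQMS.{v}) : ℝ≥0∞ :=
  ⨅ L ∈ inducingLipNorms A B,
    @Metric.hausdorffEDist _ (stateEMetric L) (statesLeft A B) (statesRight A B)

/-! ## Completions, closures and isometries -/

/-- An isomorphism of order-unit spaces: a linear bijection which preserves the unit and which,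
together with its inverse, preserves the order. -/
structure OrderUnitIso (A : Type u) (B : Type v) [AddCommMonoid A] [Module ℝ A] [LE A] [One A]
    [AddCommMonoid B] [Module ℝ B] [LE B] [One B] extends A ≃ₗ[ℝ] B where
  map_le_map_iff' : ∀ x y, toFun x ≤ toFun y ↔ x ≤ y
  map_one' : toFun 1 = 1

namespace CQMS

/-- The completion of `A` for the order-unit norm; a Banach space. -/
abbrev Completion (A : CQMS.{u}) : Type u := UniformSpace.Completion (Normed A.carrier)

/-- The canonical map of `A` into its completion. -/
noncomputable def toCompletion (A : CQMS.{u}) (a : A.carrier) : A.Completion :=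
  ((toNormed a : Normed A.carrier) : UniformSpace.Completion (Normed A.carrier))

/-- The order on the completion: its positive cone is the closure of that of `A`. -/
noncomputable instance (A : CQMS.{u}) : LE A.Completion where
  le x y := y - x ∈ closure (A.toCompletion '' {a | 0 ≤ a})

noncomputable instance (A : CQMS.{u}) : One A.Completion where
  one := A.toCompletion 1

/-- The closure in the completion of the unit ball `{a : L a ≤ 1}`. -/
def closedBall (A : CQMS.{u}) : Set A.Completion := closure (A.toCompletion '' {a | A.L a ≤ 1})

/-- The space `A^c` of the closure `(A^c, L^c)` of `(A, L)`: the subspace of the completion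
spanned by the closure of the unit ball. -/
noncomputable def closureSpace (A : CQMS.{u}) : Submodule ℝ A.Completion :=
  Submodule.span ℝ A.closedBall

/-- The seminorm `L^c` of the closure `(A^c, L^c)`: the gauge of the closure of the unit ball.
It is meaningful on `closureSpace A`. -/
noncomputable def closureL (A : CQMS.{u}) (x : A.Completion) : ℝ := gauge A.closedBall x

theorem one_mem_closureSpace (A : CQMS.{u}) : (1 : A.Completion) ∈ A.closureSpace := by
  refine Submodule.subset_span (subset_closure ⟨1, ?_, rfl⟩)
  have : A.L 1 = 0 := (A.isLipNorm.eq_zero_iff 1).2 ⟨1, (one_smul _ _).symm⟩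
  simp [this]

noncomputable instance (A : CQMS.{u}) : One A.closureSpace := ⟨⟨1, A.one_mem_closureSpace⟩⟩

/-- An isometry between compact quantum metric spaces is an isomorphism of order-unit spaces
between their closures that carries one closed Lip-norm to the other. -/
def Isometric (A : CQMS.{u}) (B : CQMS.{v}) : Prop :=
  ∃ φ : OrderUnitIso A.closureSpace B.closureSpace,
    ∀ x : A.closureSpace, B.closureL (φ.toLinearEquiv x) = A.closureL x

/-- Isometry is an equivalence relation. -/
instance isometrySetoid : Setoid CQMS.{u} where
  r := Isometric
  iseqv :=
    { refl := fun A => ⟨⟨LinearEquiv.refl ℝ _, fun _ _ => Iff.rfl, rfl⟩, fun _ => rfl⟩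
      symm := by
        rintro A B ⟨φ, h⟩
        refine ⟨⟨φ.toLinearEquiv.symm, fun x y => ?_, ?_⟩, fun x => ?_⟩
        · have := φ.map_le_map_iff' (φ.toLinearEquiv.symm x) (φ.toLinearEquiv.symm y)
          change φ.toLinearEquiv _ ≤ φ.toLinearEquiv _ ↔ _ at this
          rw [LinearEquiv.apply_symm_apply, LinearEquiv.apply_symm_apply] at this
          exact this.symm
        · exact φ.toLinearEquiv.symm_apply_eq.2 φ.map_one'.symm
        · rw [← h, LinearEquiv.apply_symm_apply]
      trans := by
        rintro A B C ⟨φ, h⟩ ⟨ψ, k⟩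
        refine ⟨⟨φ.toLinearEquiv.trans ψ.toLinearEquiv, fun x y => ?_, ?_⟩, fun x => ?_⟩
        · exact (ψ.map_le_map_iff' _ _).trans (φ.map_le_map_iff' x y)
        · exact (congrArg ψ.toLinearEquiv φ.map_one').trans ψ.map_one'
        · exact (k _).trans (h x) }

end CQMS

/-- The space of isometry classes of compact quantum metric spaces. -/
def QSpace : Type (u + 1) := Quotient CQMS.isometrySetoid.{u}

/-- The isometry class of a compact quantum metric space. -/
def QSpace.mk (A : CQMS.{u}) : QSpace.{u} := Quotient.mk _ A

/-- The topology of `dist_q` on the space of isometry classes: a set is open if around each of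
its points it contains a `dist_q`-ball of positive radius. (`dist_q` depends only on the isometry
classes and is a metric on them, with `∞` allowed, so this is the metric topology.) -/
instance : TopologicalSpace QSpace.{u} where
  IsOpen U := ∀ A : CQMS.{u}, QSpace.mk A ∈ U →
    ∃ ε : ℝ≥0∞, 0 < ε ∧ ∀ B : CQMS.{u}, distq A B < ε → QSpace.mk B ∈ U
  isOpen_univ := fun _ _ => ⟨1, one_pos, fun _ _ => trivial⟩
  isOpen_inter := fun _ _ hU hV A hA => by
    obtain ⟨ε, hε, h⟩ := hU A hA.1
    obtain ⟨δ, hδ, k⟩ := hV A hA.2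
    exact ⟨min ε δ, lt_min hε hδ, fun B hB =>
      ⟨h B (hB.trans_le (min_le_left _ _)), k B (hB.trans_le (min_le_right _ _))⟩⟩
  isOpen_sUnion := fun S hS A => by
    rintro ⟨U, hU, hA⟩
    obtain ⟨ε, hε, h⟩ := hS U hU A hA
    exact ⟨ε, hε, fun B hB => ⟨U, hU, h B hB⟩⟩

/-! ## Ordinary compact metric spaces -/

section Ordinary

variable (X : Type u) [MetricSpace X] [CompactSpace X]

/-- The real-valued Lipschitz functions, as a subspace of `C(X)`. -/
def lipSubmodule : Submodule ℝ C(X, ℝ) where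
  carrier := {f | ∃ K, LipschitzWith K f}
  zero_mem' := ⟨0, LipschitzWith.const 0⟩
  add_mem' := by
    rintro f g ⟨K, hf⟩ ⟨K', hg⟩
    exact ⟨K + K', hf.add hg⟩
  smul_mem' := by
    rintro c f ⟨K, hf⟩
    exact ⟨‖c‖₊ * K, (lipschitzWith_smul c).comp hf⟩

/-- The order-unit space of Lipschitz functions, with the pointwise order and the constant
function `1` as unit. -/
abbrev LipFun : Type u := lipSubmodule X

instance : One (LipFun X) := ⟨⟨1, 0, LipschitzWith.const 1⟩⟩

instance : PosSMulMono ℝ (LipFun X) where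
  smul_le_smul_of_nonneg_left _ hr _ _ h := fun x => mul_le_mul_of_nonneg_left (h x) hr

instance : OrderUnitSpace (LipFun X) where
  unit_nonneg := fun _ => zero_le_one
  exists_le f := ⟨‖f.1‖, fun x => by
    change f.1 x ≤ ‖f.1‖ * 1
    rw [mul_one]
    exact (le_abs_self _).trans (f.1.norm_coe_le_norm x)⟩
  archimedean f h := fun x => by
    change f.1 x ≤ 0
    refine le_of_forall_pos_le_add fun ε hε => ?_
    have h1 : f.1 x ≤ ε * 1 := h ε hε x
    linarith

variable {X} in
/-- `L_ρ(f) = sup {|f x - f y| / ρ(x, y) : x ≠ y}` (for Lipschitz `f`). -/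
noncomputable def lipConst (f : X → ℝ) : ℝ :=
  ⨆ p : {p : X × X // p.1 ≠ p.2}, |f p.1.1 - f p.1.2| / dist p.1.1 p.1.2

variable {X} in
theorem lipConst_bddAbove {f : X → ℝ} {K : NNReal} (hf : LipschitzWith K f) :
    ∀ p : {p : X × X // p.1 ≠ p.2}, |f p.1.1 - f p.1.2| / dist p.1.1 p.1.2 ≤ K := by
  intro p
  rw [div_le_iff₀ (dist_pos.2 p.2)]
  exact hf.dist_le_mul _ _

variable {X} in
theorem lipConst_nonneg (f : X → ℝ) : 0 ≤ lipConst f :=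
  Real.iSup_nonneg fun _ => by positivity

variable {X} in
theorem abs_sub_le_lipConst (f : LipFun X) (x y : X) :
    |f.1 x - f.1 y| ≤ lipConst f.1 * dist x y := by
  obtain ⟨K, hK⟩ := f.2
  rcases eq_or_ne x y with rfl | h
  · simp
  · rw [← div_le_iff₀ (dist_pos.2 h)]
    exact le_ciSup (f := fun p : {p : X × X // p.1 ≠ p.2} =>
      |f.1 p.1.1 - f.1 p.1.2| / dist p.1.1 p.1.2)
      ⟨K, Set.forall_mem_range.2 (lipConst_bddAbove hK)⟩ ⟨(x, y), h⟩

variable {X} in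
theorem lipConst_le {f : X → ℝ} {K : ℝ} (hK : 0 ≤ K)
    (h : ∀ x y, |f x - f y| ≤ K * dist x y) : lipConst f ≤ K :=
  Real.iSup_le (fun p => by rw [div_le_iff₀ (dist_pos.2 p.2)]; exact h _ _) hK

/-- The Lipschitz seminorm `L_ρ` on the Lipschitz functions. -/
noncomputable def lipSeminorm : Seminorm ℝ (LipFun X) :=
  Seminorm.ofSMulLE (fun f => lipConst f.1)
    (le_antisymm (lipConst_le le_rfl fun x y => by simp) (lipConst_nonneg _))
    (fun f g => lipConst_le (add_nonneg (lipConst_nonneg _) (lipConst_nonneg _)) fun x y => by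
      have h1 := abs_sub_le_lipConst f x y
      have h2 := abs_sub_le_lipConst g x y
      have e : (f + g).1 x - (f + g).1 y = (f.1 x - f.1 y) + (g.1 x - g.1 y) := by
        change f.1 x + g.1 x - (f.1 y + g.1 y) = _
        ring
      rw [e, add_mul]
      exact (abs_add_le _ _).trans (add_le_add h1 h2))
    (fun c f => lipConst_le (mul_nonneg (norm_nonneg c) (lipConst_nonneg _)) fun x y => by
      have e : (c • f).1 x - (c • f).1 y = c * (f.1 x - f.1 y) := by
        change c * f.1 x - c * f.1 y = _
        ring
      rw [e, abs_mul, mul_assoc]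
      exact mul_le_mul_of_nonneg_left (abs_sub_le_lipConst f x y) (abs_nonneg c))

theorem lipSeminorm_net (ε : ℝ) (hε : 0 < ε) : ∃ F : Set (LipFun X), F.Finite ∧
    ∀ f : LipFun X, lipSeminorm X f ≤ 1 → ∃ g ∈ F, ∃ c : ℝ,
      ouNorm (f - g - c • (1 : LipFun X)) ≤ ε := by
  rcases isEmpty_or_nonempty X with hX | ⟨⟨x₀⟩⟩
  · refine ⟨{0}, Set.finite_singleton _, fun f _ => ⟨0, rfl, 0, ?_⟩⟩
    exact ouNorm_le hε.le (fun x => hX.elim x) (fun x => hX.elim x)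
  let S : Set (BoundedContinuousFunction X ℝ) :=
    {h | h x₀ = 0 ∧ LipschitzWith 1 h}
  have hS : IsCompact (closure S) := by
    refine BoundedContinuousFunction.arzela_ascoli
      (Metric.closedBall (0 : ℝ) (Metric.diam (Set.univ : Set X))) (isCompact_closedBall _ _) S
      ?_ ?_
    · intro h x hh
      have h1 := hh.2.dist_le_mul x x₀
      rw [hh.1] at h1
      refine Metric.mem_closedBall.2 (h1.trans ?_)
      rw [NNReal.coe_one, one_mul]
      exact Metric.dist_le_diam_of_mem isCompact_univ.isBounded trivial trivial
    · refine UniformEquicontinuous.equicontinuous ?_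
      exact LipschitzWith.uniformEquicontinuous _ 1 fun h => h.2.2
  obtain ⟨t, htS, htf, ht⟩ := Metric.finite_approx_of_totallyBounded
    (hS.totallyBounded.subset subset_closure) ε hε
  have hinj : Function.Injective fun g : LipFun X =>
      BoundedContinuousFunction.mkOfCompact g.1 := fun g g' hg =>
    Subtype.ext (ContinuousMap.ext fun x => DFunLike.congr_fun hg x)
  refine ⟨_, htf.preimage hinj.injOn, fun f hf => ?_⟩
  have hfS : BoundedContinuousFunction.mkOfCompact f.1 -
      BoundedContinuousFunction.const X (f.1 x₀) ∈ S := by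
    refine ⟨sub_self _, LipschitzWith.of_dist_le_mul fun x y => ?_⟩
    change |(f.1 x - f.1 x₀) - (f.1 y - f.1 x₀)| ≤ _
    rw [sub_sub_sub_cancel_right, NNReal.coe_one]
    exact (abs_sub_le_lipConst f x y).trans (mul_le_mul_of_nonneg_right hf dist_nonneg)
  obtain ⟨h, hht, hh⟩ := Set.mem_iUnion₂.1 (ht hfS)
  refine ⟨⟨h.toContinuousMap, 1, (htS hht).2⟩, ?_, f.1 x₀, ?_⟩
  · exact hht
  · have hp : ∀ x, |f.1 x - f.1 x₀ - h x| ≤ ε := fun x =>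
      (BoundedContinuousFunction.dist_coe_le_dist (f := BoundedContinuousFunction.mkOfCompact f.1 -
        BoundedContinuousFunction.const X (f.1 x₀)) (g := h) x).trans (le_of_lt hh)
    refine ouNorm_le hε.le (fun x => ?_) (fun x => ?_)
    · change -(ε * 1) ≤ f.1 x - h x - f.1 x₀ * 1
      linarith [(abs_le.1 (hp x)).1]
    · change f.1 x - h x - f.1 x₀ * 1 ≤ ε * 1
      linarith [(abs_le.1 (hp x)).2]

/-- The compact quantum metric space `(C(X), L_ρ)` of an ordinary compact metric space: the
Lipschitz functions on `X` with the Lipschitz seminorm. -/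
noncomputable def CQMS.ofMetric : CQMS.{u} where
  carrier := LipFun X
  L := lipSeminorm X
  isLipNorm := IsLipNorm.of_finite_net _ (by
    intro f
    constructor
    · intro h
      rcases isEmpty_or_nonempty X with hX | ⟨⟨x₀⟩⟩
      · exact ⟨0, Subtype.ext (ContinuousMap.ext fun x => hX.elim x)⟩
      · refine ⟨f.1 x₀, Subtype.ext (ContinuousMap.ext fun x => ?_)⟩
        have h1 := abs_sub_le_lipConst f x x₀
        rw [show lipConst f.1 = 0 from h, zero_mul, abs_nonpos_iff, sub_eq_zero] at h1
        change f.1 x = f.1 x₀ * 1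
        rw [mul_one, h1]
    · rintro ⟨r, rfl⟩
      refine le_antisymm (lipConst_le le_rfl fun x y => ?_) (lipConst_nonneg _)
      change |r * 1 - r * 1| ≤ _
      simp) (lipSeminorm_net X)

end Ordinary

end QGH

namespace QGH

/-! ### States, the order and the metric `rho` on an order-unit space -/

section OrderUnit

variable {A : Type u} [AddCommGroup A] [PartialOrder A] [IsOrderedAddMonoid A]
  [Module ℝ A] [PosSMulMono ℝ A] [One A] [OrderUnitSpace A]

/-! What survives in the limit is a lattice property: the maximum of two functions with Lipschitz
constant at most `1` again has Lipschitz constant at most `1`.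

Let `(A, L)` be a limit of spaces `C(X n)`. A Lip-norm on a direct sum that makes the two state
spaces close relates the two unit balls, through the pairs on which it is below `1`, and
neighbouring states nearly agree on all of these pairs at once (`IsLink`, `IsBridge`). Each point of
`X n` is therefore close to a state of `A`. The ultralimits of such points form a weak-* closed set
`Y` of states (`limitStates`), which is a compact metric space for `rho A.L`. It is large enough to
determine the order of `A` (`eval_le_of_limitStates`). By compactness all its points are
simultaneously close to points of a single `X n` (`eventually_forall_limitStates`), so maxima taken
on `X n` can be carried back to `A`: as functions on `Y`, the unit ball of `L` is approximately
closed under maxima (`exists_max_limitStates`).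

The closure of this ball in `C(Y)` is then a lattice containing the constants. Since the metric of
`Y` is `rho A.L`, it approximates any 1-Lipschitz function at any two points, so by
Stone-Weierstrass for lattices (`mem_closure_of_two_point`) it consists of all 1-Lipschitz functions
(`isModel_evalMap`). Such a model determines everything else: Lipschitz functions are dense, so the
completion of `A` is `C(Y)`, and the gauge of the ball is the Lipschitz constant
(`IsModel.exists_iso`). Closedness follows because models can be transported along isometries and
spaces with models over one metric space are isometric (`IsModel.of_isometric`,
`IsModel.isometric`). -/

theorem norm_toNormed_one_le : ‖(toNormed 1 : Normed A)‖ ≤ 1 :=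
  ouNorm_le (A := A) zero_le_one
    (by rw [one_smul]; exact (neg_nonpos.2 (OrderUnitSpace.unit_nonneg (A := A))).trans
          OrderUnitSpace.unit_nonneg) (one_smul ℝ (1 : A)).ge

/-- `‖a‖ ≤ r` means `-r e ≤ a ≤ r e`: the infimum defining the norm is attained. -/
theorem ouNorm_le_iff {a : A} {r : ℝ} :
    ouNorm a ≤ r ↔ 0 ≤ r ∧ -(r • (1 : A)) ≤ a ∧ a ≤ r • (1 : A) := by
  refine ⟨fun h => ?_, fun h => ouNorm_le h.1 h.2.1 h.2.2⟩
  have key : ∀ s : ℝ, 0 < s → -((r + s) • (1 : A)) ≤ a ∧ a ≤ (r + s) • (1 : A) := fun s hs =>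
    le_of_ouNorm_lt (by linarith)
  refine ⟨(ouNorm_nonneg a).trans h, ?_, ?_⟩
  · rw [neg_le, ← sub_nonpos]
    refine OrderUnitSpace.archimedean _ fun s hs => ?_
    rw [sub_le_iff_le_add', ← add_smul]
    exact neg_le.1 (key s hs).1
  · rw [← sub_nonpos]
    refine OrderUnitSpace.archimedean _ fun s hs => ?_
    rw [sub_le_iff_le_add', ← add_smul]
    exact (key s hs).2

/-- The positive cone is closed for the order-unit norm. -/
theorem nonneg_of_forall_approx {a : A} (h : ∀ ε : ℝ, 0 < ε → ∃ b : A, 0 ≤ b ∧ ouNorm (a - b) ≤ ε) :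
    0 ≤ a := by
  rw [← neg_nonpos]
  refine OrderUnitSpace.archimedean _ fun r hr => ?_
  obtain ⟨b, hb, hab⟩ := h r hr
  have := (ouNorm_le_iff.1 hab).2.1
  rw [neg_le] at this
  refine le_trans ?_ this
  rw [neg_sub, neg_eq_zero_sub]
  exact sub_le_sub_right hb a

theorem isClosed_nonneg : IsClosed {a : Normed A | (0 : A) ≤ (a : A)} := by
  refine isClosed_of_closure_subset fun a ha => ?_
  refine nonneg_of_forall_approx (A := A) fun ε hε => ?_
  obtain ⟨b, hb, hab⟩ := Metric.mem_closure_iff.1 ha ε hε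
  refine ⟨b, hb, ?_⟩
  rw [dist_eq_norm] at hab
  exact hab.le

/-- A positive unital functional is a state. -/
theorem exists_state (f : A →ₗ[ℝ] ℝ) (h1 : f 1 = 1) (hf : ∀ a, 0 ≤ a → 0 ≤ f a) :
    ∃ μ : State A, ∀ a, μ.eval a = f a := by
  have hb : ∀ a : A, |f a| ≤ ouNorm a := fun a => by
    obtain ⟨-, h2, h3⟩ := ouNorm_le_iff.1 (le_refl (ouNorm a))
    have e2 := hf _ (neg_le_iff_add_nonneg.1 h2)
    have e3 := hf _ (sub_nonneg.2 h3)
    rw [map_add, map_smul, h1, smul_eq_mul, mul_one] at e2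
    rw [map_sub, map_smul, h1, smul_eq_mul, mul_one] at e3
    rw [abs_le]
    constructor <;> linarith
  let g : StrongDual ℝ (Normed A) := LinearMap.mkContinuous
    (show Normed A →ₗ[ℝ] ℝ from f) 1 (fun a => by rw [one_mul]; exact hb a)
  have hg : ∀ a : A, g (toNormed a) = f a := fun _ => rfl
  refine ⟨⟨StrongDual.toWeakDual g, (hg 1).trans h1, ?_⟩, fun a => hg a⟩
  change ‖g‖ = 1
  refine le_antisymm (LinearMap.mkContinuous_norm_le _ zero_le_one _) ?_
  have h2 := g.le_opNorm (toNormed 1)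
  rw [hg, h1, norm_one] at h2
  nlinarith [norm_nonneg g, norm_toNormed_one_le (A := A)]

/-- Only the norm bound is available for a state. For `a ≥ 0` the element `a - ‖a‖e` lies between
`-‖a‖e` and `0`, so its value is at least `-‖a‖`. -/
theorem State.eval_nonneg (μ : State A) {a : A} (ha : 0 ≤ a) : 0 ≤ μ.eval a := by
  have h0 := ouNorm_nonneg a
  obtain ⟨-, -, h3⟩ := ouNorm_le_iff.1 (le_refl (ouNorm a))
  have h : ouNorm (a - ouNorm a • (1 : A)) ≤ ouNorm a := by
    refine ouNorm_le h0 ?_ ?_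
    · rw [neg_eq_zero_sub]
      exact sub_le_sub_right ha _
    · exact (sub_nonpos.2 h3).trans (smul_nonneg h0 OrderUnitSpace.unit_nonneg)
  have := (abs_le.1 ((μ.abs_eval_le _).trans h)).1
  rw [State.eval_sub, State.eval_smul, State.eval_one] at this
  linarith

theorem State.eval_le (μ : State A) {a : A} {r : ℝ} (h : a ≤ r • (1 : A)) : μ.eval a ≤ r := by
  have := μ.eval_nonneg (sub_nonneg.2 h)
  rw [State.eval_sub, State.eval_smul, State.eval_one] at this
  linarith

/-- States detect the order. -/
theorem nonneg_of_forall_state {a : A} (h : ∀ μ : State A, 0 ≤ μ.eval a) : 0 ≤ a := by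
  by_contra hn
  have hconv : Convex ℝ {a : Normed A | (0 : A) ≤ (a : A)} := by
    intro x hx y hy s t hs ht _
    exact add_nonneg (α := A) (smul_nonneg (α := ℝ) (β := A) hs hx)
      (smul_nonneg (α := ℝ) (β := A) ht hy)
  obtain ⟨f, c, hf, hc⟩ := geometric_hahn_banach_point_closed hconv isClosed_nonneg
    (show toNormed a ∉ {a : Normed A | (0 : A) ≤ (a : A)} from hn)
  have hc0 : c < 0 := by
    have := hc 0 (le_refl (0 : A))
    rwa [map_zero] at this
  -- A functional bounded below on a cone is nonnegative there: otherwise some positive multiple of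
  -- `b` would take exactly the excluded value `c`.
  have hpos : ∀ b : A, 0 ≤ b → 0 ≤ f (toNormed b) := by
    intro b hb
    by_contra! hlt
    have h1 := hc ((c / f (toNormed b)) • toNormed b)
      (smul_nonneg (α := ℝ) (β := A) (div_nonneg_of_nonpos hc0.le hlt.le) hb)
    rw [map_smul, smul_eq_mul, div_mul_cancel₀ _ hlt.ne] at h1
    exact lt_irrefl _ h1
  let g : A →ₗ[ℝ] ℝ := (show Normed A →ₗ[ℝ] ℝ from f)
  have hg : ∀ b : A, g b = f (toNormed b) := fun _ => rfl
  -- If `g 1 = 0`, then `-a ≤ r e` forces `g a ≥ 0`, against `g a < c < 0`. So `g` can be normalised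
  -- to a state.
  have h1 : 0 < g 1 := by
    obtain ⟨r, hr⟩ := OrderUnitSpace.exists_le (-a)
    have h2 := hpos _ (sub_nonneg.2 hr)
    rw [← hg, map_sub, map_smul, map_neg, smul_eq_mul] at h2
    have h3 := hpos 1 OrderUnitSpace.unit_nonneg
    rw [← hg] at h3 hf
    rcases h3.lt_or_eq with h4 | h4
    · exact h4
    · rw [← h4] at h2
      linarith
  obtain ⟨μ, hμ⟩ := exists_state ((g 1)⁻¹ • g) (by simp [h1.ne']) (fun b hb => by
    rw [LinearMap.smul_apply, smul_eq_mul]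
    exact mul_nonneg (inv_nonneg.2 h1.le) (hpos b hb))
  have h2 := h μ
  rw [hμ, LinearMap.smul_apply, smul_eq_mul] at h2
  rw [← hg] at hf
  have := mul_neg_of_pos_of_neg (inv_pos.2 h1) (hf.trans hc0)
  linarith

/-- Banach-Alaoglu: once `μ e = 1`, the condition `‖μ‖ = 1` weakens to `‖μ‖ ≤ 1`, because `‖e‖ ≤ 1`.
What remains is a weak-* closed slice of the dual unit ball. -/
instance : CompactSpace (State A) := by
  refine isCompact_iff_compactSpace.1 (show IsCompact {μ : WeakDual ℝ (Normed A) |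
    μ (toNormed 1) = 1 ∧ ‖WeakDual.toStrongDual μ‖ = 1} from ?_)
  have : {μ : WeakDual ℝ (Normed A) | μ (toNormed 1) = 1 ∧ ‖WeakDual.toStrongDual μ‖ = 1} =
      (WeakDual.toStrongDual ⁻¹' Metric.closedBall (0 : StrongDual ℝ (Normed A)) 1) ∩
        {μ | μ (toNormed 1) = 1} := by
    ext μ
    simp only [Set.mem_ofPred_eq, Set.mem_inter_iff, Set.mem_preimage, mem_closedBall_zero_iff]
    refine ⟨fun h => ⟨h.2.le, h.1⟩, fun h => ⟨h.2, le_antisymm h.1 ?_⟩⟩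
    have h2 := (WeakDual.toStrongDual μ).le_opNorm (toNormed 1)
    rw [show (WeakDual.toStrongDual μ) (toNormed 1) = 1 from h.2, norm_one] at h2
    nlinarith [norm_nonneg (WeakDual.toStrongDual μ), norm_toNormed_one_le (A := A)]
  rw [this]
  exact (WeakDual.isCompact_closedBall _ _).inter_right
    (isClosed_eq (WeakDual.eval_continuous _) continuous_const)

/-- This is the form in which the Lip-norm hypothesis is used: weak-* convergence of states is
uniform on the unit ball of `L`. -/
theorem IsLipNorm.eventually_rho_lt {L : Seminorm ℝ A} (hL : IsLipNorm L) (μ : State A)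
    {ε : ℝ≥0∞} (hε : 0 < ε) : ∀ᶠ ν in 𝓝 μ, rho L ν μ < ε := by
  have h : @nhds _ (stateEMetric L).toUniformSpace.toTopologicalSpace μ = 𝓝 μ :=
    congrArg (fun t => @nhds _ t μ) hL.topology_eq
  rw [← h]
  exact @Metric.eball_mem_nhds _ (stateEMetric L) μ ε hε

theorem rho_comm (L : Seminorm ℝ A) (μ ν : State A) : rho L μ ν = rho L ν μ :=
  (stateEMetric L).edist_comm μ ν

theorem abs_sub_le_of_rho_le {L : Seminorm ℝ A} {μ ν : State A} {δ : ℝ} (hδ : 0 ≤ δ)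
    (h : rho L μ ν ≤ ENNReal.ofReal δ) {a : A} (ha : L a ≤ 1) : |μ.eval a - ν.eval a| ≤ δ := by
  rw [← ENNReal.ofReal_le_ofReal_iff hδ]
  exact le_trans (le_iSup₂
    (f := fun (a : A) (_ : L a ≤ 1) => ENNReal.ofReal |μ.eval a - ν.eval a|) a ha) h

theorem rho_le_of_forall_lt {L : Seminorm ℝ A} {μ ν : State A} {δ : ℝ}
    (h : ∀ a, L a < 1 → |μ.eval a - ν.eval a| ≤ δ) : rho L μ ν ≤ ENNReal.ofReal δ := by
  refine iSup₂_le fun a ha => ENNReal.ofReal_le_ofReal ?_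
  have key : ∀ t : ℝ, 0 ≤ t → t < 1 → t * |μ.eval a - ν.eval a| ≤ δ := fun t h0 h1 => by
    have := h (t • a) (by
      rw [map_smul_eq_mul, Real.norm_of_nonneg h0]
      nlinarith [apply_nonneg L a])
    rwa [State.eval_smul, State.eval_smul, ← mul_sub, abs_mul, abs_of_nonneg h0] at this
  have hcont : Filter.Tendsto (fun t : ℝ => t * |μ.eval a - ν.eval a|) (𝓝[<] 1)
      (𝓝 (1 * |μ.eval a - ν.eval a|)) :=
    ((continuous_id.mul continuous_const).tendsto 1).mono_left nhdsWithin_le_nhds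
  rw [one_mul] at hcont
  refine le_of_tendsto hcont ?_
  filter_upwards [Ioo_mem_nhdsLT (show (0 : ℝ) < 1 from one_pos)] with t ht
  exact key t ht.1.le ht.2

theorem State.ext_eval {μ ν : State A} (h : ∀ a, μ.eval a = ν.eval a) : μ = ν :=
  Subtype.ext (DFunLike.ext _ _ fun a => h a)

theorem eq_of_rho_eq_zero {L : Seminorm ℝ A} {μ ν : State A} (h : rho L μ ν = 0) : μ = ν := by
  refine State.ext_eval fun a => ?_
  have := State.abs_sub_le_rho L a μ ν
  rw [h, mul_zero, nonpos_iff_eq_zero, ENNReal.ofReal_eq_zero, abs_nonpos_iff] at this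
  linarith

end OrderUnit

/-! ## Approximation by lattices of functions -/

/-- A version of the Stone-Weierstrass theorem: a function which a sublattice of `C(Y)`
approximates at any two points lies in the closure of the sublattice. -/
theorem mem_closure_of_two_point {Y : Type v} [TopologicalSpace Y] [CompactSpace Y]
    {S : Set C(Y, ℝ)} (hne : S.Nonempty) (hsup : ∀ f ∈ S, ∀ g ∈ S, f ⊔ g ∈ S)
    (hinf : ∀ f ∈ S, ∀ g ∈ S, f ⊓ g ∈ S) {f : C(Y, ℝ)}
    (h : ∀ x y, ∀ ε : ℝ, 0 < ε → ∃ g ∈ S, |g x - f x| < ε ∧ |g y - f y| < ε) :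
    f ∈ closure S := by
  rcases isEmpty_or_nonempty Y with hY | hY
  · obtain ⟨g, hg⟩ := hne
    rw [show f = g from ContinuousMap.ext fun x => hY.elim x]
    exact subset_closure hg
  refine Metric.mem_closure_iff.2 fun ε hε => ?_
  -- For fixed `x`, finitely many approximants at the pairs `(x, y)` have a minimum that is below `f
  -- + ε` everywhere and still above `f - ε` at `x`. A finite maximum of these minima over `x` then
  -- finishes.
  have step : ∀ x, ∃ g ∈ S, f x - ε < g x ∧ ∀ y, g y < f y + ε := by
    intro x
    choose g hgS hgx hgy using fun y => h x y ε hε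
    obtain ⟨t, ht⟩ := CompactSpace.elim_nhds_subcover (fun y => {z | g y z < f z + ε}) fun y =>
      (isOpen_lt (g y).continuous (f.continuous.add continuous_const)).mem_nhds (by
        change g y y < f y + ε
        linarith [(abs_lt.1 (hgy y)).2])
    have hcov : ∀ z, ∃ y ∈ t, g y z < f z + ε := fun z => by
      have := ht.ge (Set.mem_univ z)
      simpa using this
    have htne : t.Nonempty := by
      obtain ⟨y, hy, -⟩ := hcov x
      exact ⟨y, hy⟩
    refine ⟨t.inf' htne g, Finset.inf'_mem S hinf t htne g fun y _ => hgS y, ?_, fun z => ?_⟩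
    · rw [ContinuousMap.inf'_apply, Finset.lt_inf'_iff]
      intro y _
      linarith [(abs_lt.1 (hgx y)).1]
    · obtain ⟨y, hy, hlt⟩ := hcov z
      rw [ContinuousMap.inf'_apply]
      exact (Finset.inf'_le _ hy).trans_lt hlt
  choose g hgS hgx hgy using step
  obtain ⟨t, ht⟩ := CompactSpace.elim_nhds_subcover (fun x => {z | f z - ε < g x z}) fun x =>
    (isOpen_lt (f.continuous.sub continuous_const) (g x).continuous).mem_nhds (hgx x)
  have hcov : ∀ z, ∃ y ∈ t, f z - ε < g y z := fun z => by
    have := ht.ge (Set.mem_univ z)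
    simpa using this
  have htne : t.Nonempty := by
    obtain ⟨y, hy, -⟩ := hcov hY.some
    exact ⟨y, hy⟩
  refine ⟨t.sup' htne g, Finset.sup'_mem S hsup t htne g fun y _ => hgS y, ?_⟩
  rw [ContinuousMap.dist_lt_iff hε]
  intro z
  rw [ContinuousMap.sup'_apply, dist_comm, Real.dist_eq, abs_lt]
  constructor
  · obtain ⟨y, hy, hlt⟩ := hcov z
    linarith [Finset.le_sup' (fun x => g x z) hy]
  · rw [sub_lt_iff_lt_add', Finset.sup'_lt_iff]
    intro y _
    exact hgy y z

theorem continuous_sup_continuousMap {Y : Type v} [TopologicalSpace Y] [CompactSpace Y] :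
    Continuous fun p : C(Y, ℝ) × C(Y, ℝ) => p.1 ⊔ p.2 := by
  refine LipschitzWith.continuous (K := 1) (LipschitzWith.of_dist_le_mul fun p q => ?_)
  rw [NNReal.coe_one, one_mul, ContinuousMap.dist_le dist_nonneg]
  intro y
  refine (abs_max_sub_max_le_max _ _ _ _).trans (max_le ?_ ?_)
  · exact (ContinuousMap.dist_apply_le_dist (f := p.1) (g := q.1) y).trans (le_max_left _ _)
  · exact (ContinuousMap.dist_apply_le_dist (f := p.2) (g := q.2) y).trans (le_max_right _ _)

/-! ## Models of quantum metric spaces in spaces of continuous functions -/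

/-- The functions with Lipschitz constant at most `1`. -/
def LipOne {Y : Type v} [MetricSpace Y] (f : C(Y, ℝ)) : Prop := ∀ x y, |f x - f y| ≤ dist x y

theorem isClosed_lipOne {Y : Type v} [MetricSpace Y] [CompactSpace Y] :
    IsClosed {f : C(Y, ℝ) | LipOne f} := by
  have : {f : C(Y, ℝ) | LipOne f} = ⋂ (x) (y), {f : C(Y, ℝ) | |f x - f y| ≤ dist x y} := by
    ext f
    simp [LipOne]
  rw [this]
  refine isClosed_iInter fun x => isClosed_iInter fun y => isClosed_le ?_ continuous_const
  exact ((ContinuousEvalConst.continuous_eval_const x).sub (ContinuousEvalConst.continuous_eval_const y)).abs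

/-- An embedding of the order-unit space `A` into `C(Y)` such that the closure of the unit ball
for `L` becomes the set of functions with Lipschitz constant at most `1`. -/
structure IsModel (A : CQMS.{u}) (Y : Type v) [MetricSpace Y] [CompactSpace Y]
    (Ψ : A.carrier →ₗ[ℝ] C(Y, ℝ)) : Prop where
  map_one : Ψ 1 = 1
  nonneg_iff : ∀ a, 0 ≤ Ψ a ↔ 0 ≤ a
  lipOne_iff : ∀ f, LipOne f ↔ f ∈ closure (Ψ '' {a | A.L a ≤ 1})

section LatticeModel

variable (A : CQMS.{u}) {Y : Type v} [MetricSpace Y] (ι : Y → State A.carrier)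

theorem lipschitz_eval {ι : Y → State A.carrier}
    (hι : ∀ x y, rho A.L (ι x) (ι y) = edist x y) (a : A.carrier) :
    LipschitzWith (A.L a + 1).toNNReal fun y => (ι y).eval a := by
  intro x y
  rw [edist_dist, Real.dist_eq, ← hι]
  exact State.abs_sub_le_rho A.L a _ _

/-- The map of `A` into `C(Y)` given by a family of states indexed by `Y`. -/
noncomputable def evalMap (hι : ∀ x y, rho A.L (ι x) (ι y) = edist x y) :
    A.carrier →ₗ[ℝ] C(Y, ℝ) where
  toFun a := ⟨fun y => (ι y).eval a, (lipschitz_eval A hι a).continuous⟩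
  map_add' a b := ContinuousMap.ext fun y => (ι y).eval_add a b
  map_smul' r a := ContinuousMap.ext fun y => (ι y).eval_smul r a

variable {A ι} in
theorem closure_image_lt (Ψ : A.carrier →ₗ[ℝ] C(Y, ℝ)) [CompactSpace Y] :
    closure (Ψ '' {a | A.L a ≤ 1}) = closure (Ψ '' {a | A.L a < 1}) := by
  refine subset_antisymm (closure_minimal ?_ isClosed_closure)
    (closure_mono (Set.image_mono fun a (ha : A.L a < 1) => ha.le))
  rintro _ ⟨a, ha, rfl⟩
  have hcont : Filter.Tendsto (fun t : ℝ => t • Ψ a) (𝓝[<] 1) (𝓝 ((1 : ℝ) • Ψ a)) :=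
    ((continuous_id.smul continuous_const).tendsto 1).mono_left nhdsWithin_le_nhds
  rw [one_smul] at hcont
  refine mem_closure_of_tendsto hcont ?_
  filter_upwards [Ioo_mem_nhdsLT (show (0 : ℝ) < 1 from one_pos)] with t ht
  refine ⟨t • a, ?_, map_smul _ _ _⟩
  change A.L (t • a) < 1
  rw [map_smul_eq_mul, Real.norm_of_nonneg ht.1.le]
  have h1 : A.L a ≤ 1 := ha
  nlinarith [apply_nonneg A.L a, ht.1, ht.2]

/-- If a compact metric space of states determines the order, has the metric `ρ_L`, and the unit
ball of `L` is approximately closed under pointwise maxima, then it gives a model. -/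
theorem isModel_evalMap [CompactSpace Y] (hι : ∀ x y, rho A.L (ι x) (ι y) = edist x y)
    (hord : ∀ a, (∀ y, 0 ≤ (ι y).eval a) → 0 ≤ a)
    (hlat : ∀ a b, A.L a < 1 → A.L b < 1 → ∀ ε : ℝ, 0 < ε → ∃ c, A.L c < 1 ∧
      ∀ y, |(ι y).eval c - max ((ι y).eval a) ((ι y).eval b)| ≤ ε) :
    IsModel A Y (evalMap A ι hι) := by
  set Ψ := evalMap A ι hι with hΨ
  have hΨa : ∀ a y, Ψ a y = (ι y).eval a := fun _ _ => rfl
  refine ⟨ContinuousMap.ext fun y => (ι y).eval_one, fun a => ⟨fun h => hord a fun y => h y,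
    fun h y => (ι y).eval_nonneg h⟩, fun f => ⟨fun hf => ?_, fun hf => ?_⟩⟩
  · set S := closure (Ψ '' {a | A.L a ≤ 1}) with hS
    have hneg : ∀ f ∈ S, -f ∈ S := by
      intro f hf
      refine map_mem_closure continuous_neg hf ?_
      rintro _ ⟨a, ha, rfl⟩
      exact ⟨-a, by simpa using ha, map_neg _ _⟩
    have hsup : ∀ f ∈ S, ∀ g ∈ S, f ⊔ g ∈ S := by
      intro f hf g hg
      rw [hS, closure_image_lt] at hf hg
      rw [hS, ← closure_closure]
      refine map_mem_closure₂ (f := fun f g : C(Y, ℝ) => f ⊔ g) continuous_sup_continuousMap hf hg ?_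
      rintro _ ⟨a, ha, rfl⟩ _ ⟨b, hb, rfl⟩
      refine Metric.mem_closure_iff.2 fun ε hε => ?_
      obtain ⟨c, hc, h⟩ := hlat a b ha hb (ε / 2) (half_pos hε)
      refine ⟨_, ⟨c, le_of_lt hc, rfl⟩, ?_⟩
      rw [dist_comm]
      refine lt_of_le_of_lt ((ContinuousMap.dist_le (half_pos hε).le).2 fun y => h y)
        (half_lt_self hε)
    have hinf : ∀ f ∈ S, ∀ g ∈ S, f ⊓ g ∈ S := by
      intro f hf g hg
      have := hneg _ (hsup _ (hneg f hf) _ (hneg g hg))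
      rwa [← neg_inf, neg_neg] at this
    have hS0 : S.Nonempty := ⟨_, subset_closure ⟨0, by simp, rfl⟩⟩
    refine (isClosed_closure (s := Ψ '' {a | A.L a ≤ 1})).closure_subset ?_
    refine mem_closure_of_two_point hS0 hsup hinf fun x y ε hε => ?_
    rcases eq_or_ne x y with rfl | hxy
    · refine ⟨_, subset_closure ⟨f x • (1 : A.carrier), ?_, rfl⟩, ?_⟩
      · change A.L _ ≤ 1
        rw [(A.isLipNorm.eq_zero_iff _).2 ⟨_, rfl⟩]
        exact zero_le_one
      · rw [hΨa, State.eval_smul, State.eval_one, mul_one, sub_self, abs_zero]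
        exact ⟨hε, hε⟩
    -- The distance is the supremum `rho`, so an element of the unit ball nearly attains it. The
    -- `min` keeps the lower bound nonnegative, which makes the increment `D` positive.
    obtain ⟨a, ha, had⟩ : ∃ a, A.L a ≤ 1 ∧ dist x y - min ε (dist x y) <
        (ι x).eval a - (ι y).eval a := by
      have hd := dist_pos.2 hxy
      have hm : 0 < min ε (dist x y) := lt_min hε hd
      have hlt : ENNReal.ofReal (dist x y - min ε (dist x y)) < rho A.L (ι x) (ι y) := by
        rw [hι, edist_dist]
        exact (ENNReal.ofReal_lt_ofReal_iff hd).2 (by linarith)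
      obtain ⟨a, ha⟩ := lt_iSup_iff.1 hlt
      obtain ⟨ha1, ha⟩ := lt_iSup_iff.1 ha
      have h3 := (ENNReal.ofReal_lt_ofReal_iff_of_nonneg
        (sub_nonneg.2 (min_le_right _ _))).1 ha
      rcases abs_cases ((ι x).eval a - (ι y).eval a) with hc | hc
      · exact ⟨a, ha1, by rw [hc.1] at h3; exact h3⟩
      · refine ⟨-a, by rwa [map_neg_eq_map], ?_⟩
        have e : ∀ μ : State A.carrier, μ.eval (-a) = -μ.eval a := fun μ => by
          rw [← neg_one_smul ℝ, State.eval_smul, neg_one_mul]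
        rw [e, e]
        linarith [hc.1]
    have hm := min_le_left ε (dist x y)
    have hm' := min_le_right ε (dist x y)
    set D := (ι x).eval a - (ι y).eval a with hD
    have hD0 : 0 < D := by linarith
    -- If the increment of `f` is at most `D` in absolute value, it is matched exactly. Otherwise it
    -- lies between `D` and `dist x y < D + ε` in absolute value, and `t = ±1` is good enough.
    obtain ⟨t, ht, htD⟩ : ∃ t : ℝ, |t| ≤ 1 ∧ |t * D - (f x - f y)| < ε := by
      have hfd := hf x y
      by_cases hc : |f x - f y| ≤ D
      · refine ⟨(f x - f y) / D, ?_, ?_⟩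
        · rwa [abs_div, abs_of_pos hD0, div_le_one hD0]
        · rw [div_mul_cancel₀ _ hD0.ne', sub_self, abs_zero]
          exact hε
      · push Not at hc
        rcases abs_cases (f x - f y) with h1 | h1
        · refine ⟨1, by simp, ?_⟩
          rw [one_mul, abs_lt]
          constructor <;> linarith
        · refine ⟨-1, by simp, ?_⟩
          rw [neg_one_mul, abs_lt]
          constructor <;> linarith
    -- The multiple of the unit costs nothing in `L` and makes the value at `x` exact; the error at
    -- `y` is that of the increment.
    refine ⟨_, subset_closure ⟨t • a + (f x - t * (ι x).eval a) • (1 : A.carrier), ?_, rfl⟩, ?_⟩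
    · change A.L _ ≤ 1
      refine (map_add_le_add _ _ _).trans ?_
      rw [(A.isLipNorm.eq_zero_iff ((f x - t * (ι x).eval a) • (1 : A.carrier))).2 ⟨_, rfl⟩,
        add_zero, map_smul_eq_mul, Real.norm_eq_abs]
      nlinarith [abs_nonneg t, apply_nonneg A.L a]
    · simp only [hΨa, State.eval_add, State.eval_smul, State.eval_one, mul_one]
      refine ⟨by simpa using hε, ?_⟩
      rw [abs_sub_comm] at htD
      convert htD using 2
      rw [hD]
      ring
  · refine closure_minimal ?_ isClosed_lipOne hf
    rintro _ ⟨a, ha, rfl⟩ x y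
    refine abs_sub_le_of_rho_le dist_nonneg ?_ ha
    rw [hι, edist_dist]

end LatticeModel

/-! ## Extension of models to completions -/

theorem CQMS.norm_toCompletion (A : CQMS.{u}) (a : A.carrier) :
    ‖A.toCompletion a‖ = ouNorm a :=
  UniformSpace.Completion.norm_coe (E := Normed A.carrier) (toNormed a)

/-- The canonical map of `A` into its completion, as a linear map. -/
noncomputable def CQMS.toCompletionₗ (A : CQMS.{u}) : A.carrier →ₗ[ℝ] A.Completion :=
  show Normed A.carrier →ₗ[ℝ] UniformSpace.Completion (Normed A.carrier) from
    (UniformSpace.Completion.toComplL (𝕜 := ℝ) (E := Normed A.carrier)).toLinearMap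

theorem CQMS.toCompletionₗ_apply (A : CQMS.{u}) (a : A.carrier) :
    A.toCompletionₗ a = A.toCompletion a := rfl

theorem CQMS.denseRange_toCompletion (A : CQMS.{u}) : DenseRange A.toCompletion :=
  UniformSpace.Completion.denseRange_coe (α := Normed A.carrier)

theorem CQMS.toCompletion_le_iff (A : CQMS.{u}) (a b : A.carrier) :
    A.toCompletion a ≤ A.toCompletion b ↔ a ≤ b := by
  rw [← sub_nonneg (a := b)]
  change A.toCompletionₗ b - A.toCompletionₗ a ∈ _ ↔ _
  rw [← map_sub, A.toCompletionₗ_apply]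
  refine ⟨fun h => nonneg_of_forall_approx fun ε hε => ?_, fun h => subset_closure ⟨_, h, rfl⟩⟩
  obtain ⟨_, ⟨c, hc, rfl⟩, hd⟩ := Metric.mem_closure_iff.1 h ε hε
  refine ⟨c, hc, ?_⟩
  rw [dist_eq_norm, ← A.toCompletionₗ_apply, ← A.toCompletionₗ_apply, ← map_sub,
    A.toCompletionₗ_apply, A.norm_toCompletion] at hd
  exact hd.le

/-- An `a` in `A` within `ε/2` of `x` has norm at most `r + ε/2`. Hence `(r + ε/2)e - a` is in the
cone of `A`, and it is within `ε` of `re - x`. -/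
theorem CQMS.le_smul_one_of_norm_le (A : CQMS.{u}) {x : A.Completion} {r : ℝ} (h : ‖x‖ ≤ r) :
    x ≤ r • (1 : A.Completion) := by
  change r • (1 : A.Completion) - x ∈ _
  refine Metric.mem_closure_iff.2 fun ε hε => ?_
  obtain ⟨a, ha⟩ := A.denseRange_toCompletion.exists_dist_lt x (half_pos hε)
  have hn : ouNorm a ≤ r + ε / 2 := by
    rw [← A.norm_toCompletion]
    rw [dist_eq_norm] at ha
    have := norm_sub_norm_le (A.toCompletion a) x
    rw [norm_sub_rev] at this
    linarith
  have hle := (ouNorm_le_iff.1 hn).2.2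
  refine ⟨_, ⟨(r + ε / 2) • (1 : A.carrier) - a, sub_nonneg.2 hle, rfl⟩, ?_⟩
  rw [← A.toCompletionₗ_apply, map_sub, map_smul, add_smul, dist_eq_norm]
  change ‖r • A.toCompletion 1 - x - (r • A.toCompletion 1 + (ε / 2) • A.toCompletion 1 -
    A.toCompletion a)‖ < ε
  have e : r • A.toCompletion 1 - x - (r • A.toCompletion 1 + (ε / 2) • A.toCompletion 1 -
    A.toCompletion a) = -(x - A.toCompletion a) - (ε / 2) • A.toCompletion 1 := by abel
  rw [e]
  refine (norm_sub_le _ _).trans_lt ?_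
  rw [norm_neg, ← dist_eq_norm, norm_smul, A.norm_toCompletion, Real.norm_of_nonneg (by positivity)]
  have h1 : ouNorm (1 : A.carrier) ≤ 1 := norm_toNormed_one_le
  nlinarith

section Lip

variable {Y : Type v} [MetricSpace Y]

theorem lipOne_inv_smul {f : C(Y, ℝ)} {r : ℝ} (hr : 0 < r)
    (h : ∀ x y, |f x - f y| ≤ r * dist x y) : LipOne (r⁻¹ • f) := by
  intro x y
  change |r⁻¹ * f x - r⁻¹ * f y| ≤ _
  rw [← mul_sub, abs_mul, abs_of_pos (inv_pos.2 hr), inv_mul_le_iff₀ hr]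
  exact h x y

theorem LipOne.mem_lipSubmodule [CompactSpace Y] {f : C(Y, ℝ)} (h : LipOne f) : f ∈ lipSubmodule Y :=
  ⟨1, LipschitzWith.of_dist_le_mul fun x y => by
    rw [NNReal.coe_one, one_mul]; exact h x y⟩

variable [CompactSpace Y]

theorem lipOne_inv_smul_of_lipConst_lt {f : C(Y, ℝ)} (hf : f ∈ lipSubmodule Y) {r : ℝ}
    (h : lipConst f < r) : LipOne (r⁻¹ • f) :=
  lipOne_inv_smul ((lipConst_nonneg _).trans_lt h) fun x y =>
    (abs_sub_le_lipConst ⟨f, hf⟩ x y).trans (mul_le_mul_of_nonneg_right h.le dist_nonneg)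

/-- Lipschitz functions are dense in `C(Y)`. -/
theorem dense_lipSubmodule : Dense (lipSubmodule Y : Set C(Y, ℝ)) := by
  have hsup : ∀ f ∈ lipSubmodule Y, ∀ g ∈ lipSubmodule Y, f ⊔ g ∈ lipSubmodule Y := by
    rintro f ⟨K, hf⟩ g ⟨K', hg⟩
    exact ⟨max K K', hf.max hg⟩
  have hinf : ∀ f ∈ lipSubmodule Y, ∀ g ∈ lipSubmodule Y, f ⊓ g ∈ lipSubmodule Y := by
    rintro f ⟨K, hf⟩ g ⟨K', hg⟩
    exact ⟨max K K', hf.min hg⟩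
  intro f
  refine mem_closure_of_two_point ⟨0, zero_mem _⟩ hsup hinf fun x y ε hε => ?_
  let d : C(Y, ℝ) := ⟨fun z => dist z x, continuous_id.dist continuous_const⟩
  have hd : d ∈ lipSubmodule Y := ⟨1, LipschitzWith.dist_left x⟩
  let c : C(Y, ℝ) := ContinuousMap.const Y (f x)
  have hc : c ∈ lipSubmodule Y := ⟨0, LipschitzWith.const _⟩
  refine ⟨c + ((f y - f x) / dist y x) • d, add_mem hc (Submodule.smul_mem _ _ hd), ?_, ?_⟩
  · change |f x + (f y - f x) / dist y x * dist x x - f x| < ε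
    simpa using hε
  · change |f x + (f y - f x) / dist y x * dist y x - f y| < ε
    rcases eq_or_ne y x with rfl | h
    · simpa using hε
    · rw [div_mul_cancel₀ _ (dist_pos.2 h).ne']
      simpa using hε

end Lip

namespace IsModel

variable {A : CQMS.{u}} {Y : Type v} [MetricSpace Y] [CompactSpace Y]
  {Ψ : A.carrier →ₗ[ℝ] C(Y, ℝ)}

theorem le_smul_one_iff (h : IsModel A Y Ψ) (a : A.carrier) (r : ℝ) :
    a ≤ r • (1 : A.carrier) ↔ ∀ y, Ψ a y ≤ r := by
  rw [← sub_nonneg, ← h.nonneg_iff, map_sub, map_smul, h.map_one]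
  refine forall_congr' fun y => ?_
  change 0 ≤ r * 1 - Ψ a y ↔ _
  rw [mul_one, sub_nonneg]

theorem norm_map (h : IsModel A Y Ψ) (a : A.carrier) : ‖Ψ a‖ = ouNorm a := by
  refine eq_of_forall_ge_iff fun r => ?_
  rw [ouNorm_le_iff]
  by_cases hr : 0 ≤ r
  · rw [ContinuousMap.norm_le _ hr, neg_le, h.le_smul_one_iff, h.le_smul_one_iff, map_neg,
      ← forall_and]
    simp only [hr, true_and, ContinuousMap.neg_apply, Real.norm_eq_abs, abs_le']
    exact forall_congr' fun y => and_comm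
  · exact ⟨fun h' => absurd ((norm_nonneg _).trans h') hr, fun h' => absurd h'.1 hr⟩

/-- A model as an isometric embedding of the normed space `A`. -/
noncomputable def toIsometry (h : IsModel A Y Ψ) : Normed A.carrier →ₗᵢ[ℝ] C(Y, ℝ) where
  toLinearMap := show Normed A.carrier →ₗ[ℝ] C(Y, ℝ) from Ψ
  norm_map' := h.norm_map

/-- A model preserves order and unit, hence the norm, and extends isometrically to the completion.
The range is complete, so closed; it contains the closure of the image of the unit ball, hence all
Lipschitz functions, which are dense. -/
theorem exists_isometryEquiv (h : IsModel A Y Ψ) :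
    ∃ Φ : A.Completion ≃ₗᵢ[ℝ] C(Y, ℝ), ∀ a, Φ (A.toCompletion a) = Ψ a := by
  let e : Normed A.carrier →L[ℝ] A.Completion := UniformSpace.Completion.toComplL
  have he : IsUniformInducing e := UniformSpace.Completion.isUniformInducing_coe _
  have hd : DenseRange e := UniformSpace.Completion.denseRange_coe
  let F : A.Completion →L[ℝ] C(Y, ℝ) := h.toIsometry.toContinuousLinearMap.extend e
  have hF : ∀ a, F (A.toCompletion a) = Ψ a := fun a =>
    ContinuousLinearMap.extend_eq (e := e) h.toIsometry.toContinuousLinearMap hd he (toNormed a)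
  have hn : ∀ x, ‖F x‖ = ‖x‖ := by
    intro x
    refine A.denseRange_toCompletion.induction_on x
      (isClosed_eq F.continuous.norm continuous_norm) fun a => ?_
    rw [hF, h.norm_map, A.norm_toCompletion]
  let Φ : A.Completion →ₗᵢ[ℝ] C(Y, ℝ) := ⟨F.toLinearMap, hn⟩
  have hcl : IsClosed (Set.range Φ) := Φ.isometry.isClosedEmbedding.isClosed_range
  have hball : ∀ f : C(Y, ℝ), LipOne f → f ∈ Set.range Φ := by
    intro f hf
    refine closure_minimal ?_ hcl ((h.lipOne_iff f).1 hf)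
    rintro _ ⟨a, -, rfl⟩
    exact ⟨_, hF a⟩
  have hlip : ∀ f ∈ lipSubmodule Y, f ∈ Set.range Φ := by
    intro f hf
    obtain ⟨x, hx⟩ := hball _ (lipOne_inv_smul_of_lipConst_lt hf (lt_add_one (lipConst f)))
    have h0 : 0 < lipConst f + 1 := by linarith [lipConst_nonneg f]
    refine ⟨(lipConst f + 1) • x, ?_⟩
    rw [map_smul, hx, smul_inv_smul₀ h0.ne']
  have hsurj : Function.Surjective Φ := fun f =>
    hcl.closure_subset_iff.2 hlip (dense_lipSubmodule f)
  exact ⟨LinearIsometryEquiv.ofSurjective Φ hsurj, hF⟩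

open scoped Pointwise in
/-- A model extends to an isomorphism of the completion with `C(Y)`, under which the closure of
`(A, L)` becomes the space of Lipschitz functions. -/
theorem exists_iso (h : IsModel A Y Ψ) : ∃ Φ : OrderUnitIso A.Completion C(Y, ℝ),
    (∀ a, Φ.toLinearEquiv (A.toCompletion a) = Ψ a) ∧
    (∀ x, x ∈ A.closureSpace ↔ Φ.toLinearEquiv x ∈ lipSubmodule Y) ∧
    ∀ x ∈ A.closureSpace, A.closureL x = lipConst (Φ.toLinearEquiv x) := by
  obtain ⟨Φ, hΦ⟩ := h.exists_isometryEquiv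
  have himage : ∀ s : Set A.carrier, ∀ x,
      x ∈ closure (A.toCompletion '' s) ↔ Φ x ∈ closure (Ψ '' s) := by
    intro s x
    have h1 : Ψ '' s = Φ '' (A.toCompletion '' s) := by
      rw [Set.image_image]
      exact Set.image_congr fun a _ => (hΦ a).symm
    have h2 := Φ.toHomeomorph.image_closure (A.toCompletion '' s)
    change Φ '' _ = closure (Φ '' _) at h2
    rw [h1, ← h2, Φ.injective.mem_set_image]
  have hball : ∀ x, x ∈ A.closedBall ↔ LipOne (Φ x) := fun x => by
    rw [h.lipOne_iff]
    exact himage _ x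
  have hnonneg : ∀ x, x ∈ closure (A.toCompletion '' {a | 0 ≤ a}) ↔ 0 ≤ Φ x := by
    intro x
    rw [himage]
    constructor
    · have hc : IsClosed {f : C(Y, ℝ) | 0 ≤ f} := by
        have : {f : C(Y, ℝ) | 0 ≤ f} = ⋂ y, {f : C(Y, ℝ) | 0 ≤ f y} := by
          ext f
          simp [ContinuousMap.le_def]
        rw [this]
        exact isClosed_iInter fun y => isClosed_le continuous_const
          (ContinuousEvalConst.continuous_eval_const y)
      intro hx
      refine closure_minimal ?_ hc hx
      rintro _ ⟨a, ha, rfl⟩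
      exact (h.nonneg_iff a).2 ha
    · intro hx
      refine Metric.mem_closure_iff.2 fun ε hε => ?_
      -- An approximant within `ε/4` may dip slightly below zero. Adding `(ε/2)e` puts it into the
      -- cone and keeps the total error below `ε`.
      obtain ⟨a, ha⟩ := A.denseRange_toCompletion.exists_dist_lt x (half_pos (half_pos hε))
      have hd : dist (Φ x) (Ψ a) < ε / 2 / 2 := by rwa [← hΦ, Φ.dist_map]
      refine ⟨_, ⟨a + (ε / 2) • (1 : A.carrier), ?_, rfl⟩, ?_⟩
      · refine (h.nonneg_iff _).1 fun y => ?_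
        rw [map_add, map_smul, h.map_one]
        change 0 ≤ Ψ a y + ε / 2 * 1
        have h1 := (ContinuousMap.dist_apply_le_dist (f := Φ x) (g := Ψ a) y).trans hd.le
        rw [Real.dist_eq] at h1
        have h2 : 0 ≤ Φ x y := hx y
        linarith [(abs_le.1 h1).2]
      · rw [map_add, map_smul, h.map_one]
        refine (dist_triangle _ (Ψ a) _).trans_lt ?_
        have h3 : dist (Ψ a) (Ψ a + (ε / 2) • 1) ≤ ε / 2 := by
          refine (ContinuousMap.dist_le (by positivity)).2 fun y => ?_
          change |Ψ a y - (Ψ a y + ε / 2 * 1)| ≤ _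
          rw [mul_one, sub_add_cancel_left, abs_neg, abs_of_pos (half_pos hε)]
        linarith
  have hle : ∀ x y, Φ x ≤ Φ y ↔ x ≤ y := fun x y => by
    rw [← sub_nonneg, ← map_sub]
    exact (hnonneg _).symm
  let Θ : OrderUnitIso A.Completion C(Y, ℝ) :=
    { Φ.toLinearEquiv with
      map_le_map_iff' := hle
      map_one' := (hΦ 1).trans h.map_one }
  have hΘ : ∀ x, Θ.toLinearEquiv x = Φ x := fun _ => rfl
  have hmem : ∀ x, Φ x ∈ lipSubmodule Y → ∀ r, lipConst (Φ x) < r → x ∈ r • A.closedBall := by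
    intro x hx r hr
    have h0 : 0 < r := (lipConst_nonneg _).trans_lt hr
    rw [Set.mem_smul_set_iff_inv_smul_mem₀ h0.ne', hball, map_smul]
    exact lipOne_inv_smul_of_lipConst_lt hx hr
  have hspace : ∀ x, x ∈ A.closureSpace ↔ Φ x ∈ lipSubmodule Y := by
    intro x
    constructor
    · intro hx
      have : A.closureSpace ≤ (lipSubmodule Y).comap Φ.toLinearEquiv.toLinearMap :=
        Submodule.span_le.2 fun z hz => LipOne.mem_lipSubmodule ((hball z).1 hz)
      exact this hx
    · intro hx
      obtain ⟨z, hz, hzx⟩ := hmem x hx _ (lt_add_one _)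
      have hm := Submodule.smul_mem _ (lipConst (Φ x) + 1) (Submodule.subset_span (R := ℝ) hz)
      rwa [show (lipConst (Φ x) + 1) • z = x from hzx] at hm
  refine ⟨Θ, fun a => (hΘ _).trans (hΦ a), hspace, fun x hx => ?_⟩
  rw [hΘ]
  have hx' := (hspace x).1 hx
  -- For `r > 0`, lying in `r • A.closedBall` means that the image satisfies the Lipschitz bound
  -- with constant `r`; the gauge and the Lipschitz constant are the infima of the same bounds.
  refine le_antisymm (le_of_forall_gt_imp_ge_of_dense fun r hr =>
    gauge_le_of_mem ((lipConst_nonneg _).trans hr.le) (hmem x hx' r hr)) ?_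
  refine le_csInf ⟨_, ?_, hmem x hx' _ (lt_add_one _)⟩ ?_
  · exact (lipConst_nonneg _).trans_lt (lt_add_one _)
  · rintro r ⟨hr, z, hz, rfl⟩
    have hr0 : 0 < r := hr
    refine lipConst_le hr0.le fun y y' => ?_
    have h1 := (hball z).1 hz y y'
    have e : ∀ y, Φ (r • z) y = r * Φ z y := fun y => by rw [map_smul]; rfl
    change |Φ (r • z) y - Φ (r • z) y'| ≤ _
    rw [e, e, ← mul_sub, abs_mul, abs_of_pos hr0]
    exact mul_le_mul_of_nonneg_left h1 hr0.le

end IsModel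

/-- Lipschitz functions form a model of `(C(X), L_ρ)`. -/
theorem isModel_ofMetric (X : Type v) [MetricSpace X] [CompactSpace X] :
    IsModel (CQMS.ofMetric X) X (lipSubmodule X).subtype := by
  have key : (lipSubmodule X).subtype '' {a : LipFun X | lipSeminorm X a ≤ 1} =
      {f | LipOne f} := by
    ext f
    constructor
    · rintro ⟨a, ha, rfl⟩ x y
      refine (abs_sub_le_lipConst a x y).trans ?_
      have ha' : lipConst a.1 ≤ 1 := ha
      nlinarith [dist_nonneg (x := x) (y := y)]
    · intro hf
      refine ⟨⟨f, LipOne.mem_lipSubmodule hf⟩, ?_, rfl⟩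
      exact lipConst_le zero_le_one fun x y => by rw [one_mul]; exact hf x y
  refine ⟨rfl, fun a => Iff.rfl, fun f => ?_⟩
  change _ ↔ f ∈ closure ((lipSubmodule X).subtype '' {a : LipFun X | lipSeminorm X a ≤ 1})
  rw [key, isClosed_lipOne.closure_eq]
  rfl

/-! ## Models and isometries -/

namespace CQMS

theorem closedBall_eq (A : CQMS.{u}) :
    A.closedBall = closure (A.toCompletionₗ '' A.L.closedBall 0 1) := by
  rw [Seminorm.closedBall_zero_eq]
  rfl

theorem convex_closedBall (A : CQMS.{u}) : Convex ℝ A.closedBall := by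
  rw [closedBall_eq]
  exact ((A.L.convex_closedBall 0 1).linear_image _).closure

theorem balanced_closedBall (A : CQMS.{u}) : Balanced ℝ A.closedBall := by
  rw [closedBall_eq]
  refine Balanced.closure ?_
  rintro c hc _ ⟨_, ⟨a, ha, rfl⟩, rfl⟩
  exact ⟨c • a, A.L.balanced_closedBall_zero 1 c hc ⟨a, ha, rfl⟩, map_smul _ _ _⟩

/-- The span of a nonempty convex balanced set is the union of its positive multiples. This
guarantees that the infimum defining the gauge is over a nonempty set, rather than the default value
`0`. -/
theorem exists_inv_smul_mem_closedBall (A : CQMS.{u}) {x : A.Completion}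
    (hx : x ∈ A.closureSpace) : ∃ s : ℝ, 0 < s ∧ s⁻¹ • x ∈ A.closedBall := by
  induction hx using Submodule.span_induction with
  | mem x hx => exact ⟨1, one_pos, by rwa [inv_one, one_smul]⟩
  | zero =>
    refine ⟨1, one_pos, subset_closure ⟨0, by simp, ?_⟩⟩
    rw [smul_zero, ← A.toCompletionₗ_apply, map_zero]
  | add x y _ _ hx hy =>
    obtain ⟨s, hs, hx⟩ := hx
    obtain ⟨t, ht, hy⟩ := hy
    refine ⟨s + t, add_pos hs ht, ?_⟩
    have := A.convex_closedBall hx hy (a := s / (s + t)) (b := t / (s + t)) (by positivity)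
      (by positivity) (by field_simp)
    convert this using 1
    rw [smul_smul, smul_smul, smul_add]
    congr 2 <;> field_simp
  | smul c x _ hx =>
    obtain ⟨s, hs, hx⟩ := hx
    have hc : 0 < |c| + 1 := by positivity
    refine ⟨(|c| + 1) * s, by positivity, ?_⟩
    have := A.balanced_closedBall.smul_mem (a := c / (|c| + 1)) (by
      rw [Real.norm_eq_abs, abs_div, abs_of_pos hc, div_le_one hc]
      linarith) hx
    convert this using 1
    rw [smul_smul, smul_smul]
    congr 1
    field_simp

/-- Gauge at most `1` gives membership of `s⁻¹ • x` for some `s < t⁻¹`, and balancedness then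
shrinks to `t • x`. The factor `t < 1` avoids asking whether the infimum is attained. -/
theorem smul_mem_closedBall (A : CQMS.{u}) {x : A.Completion} (hx : x ∈ A.closureSpace)
    (hL : A.closureL x ≤ 1) {t : ℝ} (h0 : 0 < t) (h1 : t < 1) : t • x ∈ A.closedBall := by
  obtain ⟨s₀, hs₀, hx₀⟩ := A.exists_inv_smul_mem_closedBall hx
  have hlt : gauge A.closedBall x < t⁻¹ := 
    lt_of_le_of_lt (show gauge A.closedBall x ≤ 1 from hL) ((one_lt_inv₀ h0).2 h1)
  rw [gauge_def'] at hlt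
  obtain ⟨s, ⟨hs, hxs⟩, hst⟩ := exists_lt_of_csInf_lt
    (show {r ∈ Set.Ioi (0 : ℝ) | r⁻¹ • x ∈ A.closedBall}.Nonempty from ⟨s₀, hs₀, hx₀⟩) hlt
  have hs' : 0 < s := hs
  have hts : t * s ≤ 1 := by
    have := mul_lt_mul_of_pos_left hst h0
    rw [mul_inv_cancel₀ h0.ne'] at this
    exact this.le
  have := A.balanced_closedBall.smul_mem (a := t * s) (by
    rwa [Real.norm_of_nonneg (by positivity)]) hxs
  rwa [smul_smul, mul_assoc, mul_inv_cancel₀ hs'.ne', mul_one] at this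

theorem toCompletion_mem_closureSpace (A : CQMS.{u}) (a : A.carrier) :
    A.toCompletion a ∈ A.closureSpace := by
  have h0 : 0 < A.L a + 1 := by linarith [apply_nonneg A.L a]
  have h : A.toCompletion ((A.L a + 1)⁻¹ • a) ∈ A.closureSpace := by
    refine Submodule.subset_span (subset_closure ⟨_, ?_, rfl⟩)
    change A.L _ ≤ 1
    rw [map_smul_eq_mul, Real.norm_of_nonneg (by positivity), inv_mul_le_iff₀ h0]
    linarith
  have := Submodule.smul_mem _ (A.L a + 1) h
  rwa [← A.toCompletionₗ_apply, map_smul, smul_inv_smul₀ h0.ne'] at this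

end CQMS

/-- Spaces with models over the same metric space are isometric. -/
theorem IsModel.isometric {A : CQMS.{u}} {B : CQMS.{v}} {Y : Type w} [MetricSpace Y]
    [CompactSpace Y] {Ψ : A.carrier →ₗ[ℝ] C(Y, ℝ)} {Ψ' : B.carrier →ₗ[ℝ] C(Y, ℝ)}
    (hA : IsModel A Y Ψ) (hB : IsModel B Y Ψ') : A.Isometric B := by
  obtain ⟨Φ, -, h1, h2⟩ := hA.exists_iso
  obtain ⟨Φ', -, h1', h2'⟩ := hB.exists_iso
  let e : A.Completion ≃ₗ[ℝ] B.Completion := Φ.toLinearEquiv.trans Φ'.toLinearEquiv.symm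
  have he : ∀ x, Φ'.toLinearEquiv (e x) = Φ.toLinearEquiv x := fun x =>
    Φ'.toLinearEquiv.apply_symm_apply _
  have hmem : ∀ x, e x ∈ B.closureSpace ↔ x ∈ A.closureSpace := fun x => by
    rw [h1, h1', he]
  have hmap : A.closureSpace.map e.toLinearMap = B.closureSpace := by
    ext y
    constructor
    · rintro ⟨x, hx, rfl⟩
      exact (hmem x).2 hx
    · intro hy
      refine ⟨e.symm y, (hmem _).1 ?_, e.apply_symm_apply y⟩
      rwa [e.apply_symm_apply]
  refine ⟨⟨e.ofSubmodules _ _ hmap, fun x y => ?_, Subtype.ext ?_⟩, fun x => ?_⟩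
  · change e x.1 ≤ e y.1 ↔ x.1 ≤ y.1
    have h3 := Φ'.map_le_map_iff' (e x.1) (e y.1)
    have h4 := Φ.map_le_map_iff' x.1 y.1
    change Φ'.toLinearEquiv _ ≤ Φ'.toLinearEquiv _ ↔ _ at h3
    change Φ.toLinearEquiv _ ≤ Φ.toLinearEquiv _ ↔ _ at h4
    rw [he, he] at h3
    exact h3.symm.trans h4
  · change e 1 = 1
    refine Φ'.toLinearEquiv.injective ?_
    rw [he]
    exact Φ.map_one'.trans Φ'.map_one'.symm
  · change B.closureL (e x.1) = A.closureL x.1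
    rw [h2 _ x.2, h2' _ ((hmem _).2 x.2), he]

/-- A space isometric to a space with a model has a model over the same metric space. -/
theorem IsModel.of_isometric {A : CQMS.{u}} {B : CQMS.{v}} {X : Type w} [MetricSpace X]
    [CompactSpace X] {Ψ : A.carrier →ₗ[ℝ] C(X, ℝ)} (hA : IsModel A X Ψ) (hBA : B.Isometric A) :
    ∃ Ψ' : B.carrier →ₗ[ℝ] C(X, ℝ), IsModel B X Ψ' := by
  obtain ⟨Φ, -, hΦ1, hΦ2⟩ := hA.exists_iso
  obtain ⟨φ, hφ⟩ := hBA
  let T : B.closureSpace →ₗ[ℝ] C(X, ℝ) :=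
    Φ.toLinearEquiv.toLinearMap ∘ₗ A.closureSpace.subtype ∘ₗ φ.toLinearEquiv.toLinearMap
  have hT : ∀ x, T x = Φ.toLinearEquiv (φ.toLinearEquiv x).1 := fun _ => rfl
  have hTle : ∀ x y, T x ≤ T y ↔ x.1 ≤ y.1 := fun x y =>
    (Φ.map_le_map_iff' _ _).trans (φ.map_le_map_iff' x y)
  have hT1 : T 1 = 1 := by
    have h := φ.map_one'
    change φ.toLinearEquiv 1 = 1 at h
    rw [hT, h]
    exact Φ.map_one'
  -- An isometry is only given as an order isomorphism of the closures. Being unital and positive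
  -- makes `T` a contraction, which is what carries norm approximation over to `C(X, ℝ)`.
  have hTnorm : ∀ x : B.closureSpace, ∀ r : ℝ, ‖x.1‖ ≤ r → ‖T x‖ ≤ r := by
    have key : ∀ x : B.closureSpace, ∀ r : ℝ, ‖x.1‖ ≤ r → ∀ y, T x y ≤ r := by
      intro x r h y
      have h1 : T x ≤ T (r • 1) := (hTle _ _).2 (B.le_smul_one_of_norm_le h)
      rw [map_smul, hT1] at h1
      have h2 : T x y ≤ r * 1 := h1 y
      linarith
    intro x r h
    refine (ContinuousMap.norm_le _ ((norm_nonneg _).trans h)).2 fun y => ?_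
    rw [Real.norm_eq_abs, abs_le']
    refine ⟨key x r h y, ?_⟩
    have := key (-x) r (by rwa [Submodule.coe_neg, norm_neg]) y
    rwa [map_neg] at this
  let j : B.carrier →ₗ[ℝ] B.closureSpace :=
    B.toCompletionₗ.codRestrict B.closureSpace B.toCompletion_mem_closureSpace
  have hj : ∀ b, (j b).1 = B.toCompletion b := fun _ => rfl
  have hTL : ∀ x : B.closureSpace, lipConst (T x) = B.closureL x := fun x => by
    rw [← hφ, hΦ2 _ (φ.toLinearEquiv x).2, hT]
  have hTlip : ∀ x : B.closureSpace, T x ∈ lipSubmodule X := fun x =>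
    (hΦ1 _).1 (φ.toLinearEquiv x).2
  refine ⟨T ∘ₗ j, hT1, fun b => ?_, fun f => ⟨fun hf => ?_, fun hf => ?_⟩⟩
  · rw [LinearMap.comp_apply, ← map_zero T, ← map_zero j, hTle, hj, hj, B.toCompletion_le_iff]
  · have hf' : f ∈ lipSubmodule X := hf.mem_lipSubmodule
    obtain ⟨x, hx⟩ : ∃ x, T x = f := by
      have hz : Φ.toLinearEquiv.symm f ∈ A.closureSpace := by
        rw [hΦ1, LinearEquiv.apply_symm_apply]
        exact hf'
      refine ⟨φ.toLinearEquiv.symm ⟨_, hz⟩, ?_⟩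
      rw [hT, LinearEquiv.apply_symm_apply, LinearEquiv.apply_symm_apply]
    have hL : B.closureL x ≤ 1 := by
      rw [← hTL, hx]
      exact lipConst_le zero_le_one fun y z => by rw [one_mul]; exact hf y z
    -- Only `t • x` with `t < 1` is known to lie in the closed ball, so `f` is reached as the limit
    -- of `t • f`.
    have hcont : Filter.Tendsto (fun t : ℝ => t • f) (𝓝[<] 1) (𝓝 ((1 : ℝ) • f)) :=
      ((continuous_id.smul continuous_const).tendsto 1).mono_left nhdsWithin_le_nhds
    rw [one_smul] at hcont
    refine isClosed_closure.mem_of_tendsto hcont ?_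
    filter_upwards [Ioo_mem_nhdsLT (show (0 : ℝ) < 1 from one_pos)] with t ht
    refine Metric.mem_closure_iff.2 fun ε hε => ?_
    obtain ⟨_, ⟨b, hb, rfl⟩, hd⟩ := Metric.mem_closure_iff.1
      (B.smul_mem_closedBall x.2 hL ht.1 ht.2) (ε / 2) (half_pos hε)
    refine ⟨_, ⟨b, hb, rfl⟩, lt_of_le_of_lt ?_ (half_lt_self hε)⟩
    rw [LinearMap.comp_apply, ← hx, ← map_smul, dist_eq_norm, ← map_sub]
    refine hTnorm _ _ ?_
    rw [dist_eq_norm] at hd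
    exact hd.le
  · refine closure_minimal ?_ isClosed_lipOne hf
    rintro _ ⟨b, hb, rfl⟩ x y
    have h1 : lipConst (T (j b)) ≤ 1 := by
      rw [hTL]
      exact gauge_le_one_of_mem (subset_closure ⟨b, hb, rfl⟩)
    refine (abs_sub_le_lipConst ⟨_, hTlip (j b)⟩ x y).trans ?_
    exact (mul_le_mul_of_nonneg_right h1 dist_nonneg).trans_eq (one_mul _)

/-! ## Relations witnessing small quantum Gromov-Hausdorff distance -/

/-- A correspondence between the open unit balls of `L_A` and `L_B` for which the state spaces
are `ε`-close. -/
structure IsLink (A : CQMS.{u}) (B : CQMS.{v}) (ε : ℝ) (P : A.carrier → B.carrier → Prop) :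
    Prop where
  left_lt : ∀ {a b}, P a b → A.L a < 1
  right_lt : ∀ {a b}, P a b → B.L b < 1
  exists_right : ∀ a, A.L a < 1 → ∃ b, P a b
  exists_left : ∀ b, B.L b < 1 → ∃ a, P a b
  near_left : ∀ μ : State A.carrier, ∃ ν : State B.carrier, ∀ a b, P a b →
    |μ.eval a - ν.eval b| ≤ ε
  near_right : ∀ ν : State B.carrier, ∃ μ : State A.carrier, ∀ a b, P a b →
    |μ.eval a - ν.eval b| ≤ ε

theorem IsLink.symm {A : CQMS.{u}} {B : CQMS.{v}} {ε : ℝ} {P : A.carrier → B.carrier → Prop}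
    (h : IsLink A B ε P) : IsLink B A ε fun b a => P a b where
  left_lt := h.right_lt
  right_lt := h.left_lt
  exists_right := h.exists_left
  exists_left := h.exists_right
  near_left ν := by
    obtain ⟨μ, hμ⟩ := h.near_right ν
    exact ⟨μ, fun b a hab => by rw [abs_sub_comm]; exact hμ a b hab⟩
  near_right μ := by
    obtain ⟨ν, hν⟩ := h.near_left μ
    exact ⟨ν, fun b a hab => by rw [abs_sub_comm]; exact hν a b hab⟩

/-- The pairs are those with `L (a, b) < 1`. The inequality is strict because the infima giving the
quotient seminorms need not be attained, whereas below `1` a partner always exists. A single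
neighbouring state serves all pairs because `rho` is a supremum over the unit ball. -/
theorem exists_isLink_of_distq_lt {A : CQMS.{u}} {B : CQMS.{v}} {ε : ℝ} (hε : 0 ≤ ε)
    (h : distq A B < ENNReal.ofReal ε) : ∃ P, IsLink A B ε P := by
  obtain ⟨L, hL⟩ := iInf_lt_iff.1 h
  obtain ⟨⟨-, hLA, hLB⟩, hL⟩ := iInf_lt_iff.1 hL
  have hbdA : ∀ a, BddBelow (Set.range fun b : B.carrier => L (a, b)) := fun a =>
    ⟨0, Set.forall_mem_range.2 fun b => apply_nonneg L _⟩
  have hbdB : ∀ b, BddBelow (Set.range fun a : A.carrier => L (a, b)) := fun b =>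
    ⟨0, Set.forall_mem_range.2 fun a => apply_nonneg L _⟩
  have hfst : ∀ μ : State A.carrier, ∃ σ : State (A.carrier × B.carrier),
      ∀ p, σ.eval p = μ.eval p.1 := fun μ => by
    let f : A.carrier × B.carrier →ₗ[ℝ] ℝ :=
      { toFun := fun p => μ.eval p.1
        map_add' := fun p q => μ.eval_add p.1 q.1
        map_smul' := fun r p => μ.eval_smul r p.1 }
    exact exists_state f μ.eval_one fun p hp => μ.eval_nonneg hp.1
  have hsnd : ∀ ν : State B.carrier, ∃ σ : State (A.carrier × B.carrier),
      ∀ p, σ.eval p = ν.eval p.2 := fun ν => by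
    let f : A.carrier × B.carrier →ₗ[ℝ] ℝ :=
      { toFun := fun p => ν.eval p.2
        map_add' := fun p q => ν.eval_add p.2 q.2
        map_smul' := fun r p => ν.eval_smul r p.2 }
    exact exists_state f ν.eval_one fun p hp => ν.eval_nonneg hp.2
  refine ⟨fun a b => L (a, b) < 1, ?_, ?_, ?_, ?_, ?_, ?_⟩
  · intro a b hab
    rw [hLA]
    exact (ciInf_le (hbdA a) b).trans_lt hab
  · intro a b hab
    rw [hLB]
    exact (ciInf_le (hbdB b) a).trans_lt hab
  · intro a ha
    rw [hLA] at ha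
    exact exists_lt_of_ciInf_lt ha
  · intro b hb
    rw [hLB] at hb
    exact exists_lt_of_ciInf_lt hb
  · intro μ
    obtain ⟨σ, hσ⟩ := hfst μ
    obtain ⟨τ, ⟨ν, hν⟩, hτ⟩ := @Metric.exists_edist_lt_of_hausdorffEDist_lt _ (stateEMetric L)
      σ _ _ _ (show σ ∈ statesLeft A B from ⟨μ, hσ⟩) hL
    refine ⟨ν, fun a b hab => ?_⟩
    have := abs_sub_le_of_rho_le hε (le_of_lt hτ) (le_of_lt hab)
    rwa [hσ, hν] at this
  · intro ν
    obtain ⟨σ, hσ⟩ := hsnd ν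
    obtain ⟨τ, ⟨μ, hμ⟩, hτ⟩ := @Metric.exists_edist_lt_of_hausdorffEDist_lt _ (stateEMetric L)
      σ _ _ _ (show σ ∈ statesRight A B from ⟨ν, hσ⟩)
      (lt_of_eq_of_lt (@Metric.hausdorffEDist_comm _ (stateEMetric L) _ _) hL)
    refine ⟨μ, fun a b hab => ?_⟩
    have := abs_sub_le_of_rho_le hε (le_of_lt hτ) (le_of_lt hab)
    rwa [hσ, hμ, abs_sub_comm] at this

/-- A correspondence between the functions with Lipschitz constant at most `1` on `X` and the
open unit ball of `A`, for which points of `X` are `ε`-close to states of `A` and the upper bounds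
of corresponding elements are `ε`-close. -/
structure IsBridge (A : CQMS.{u}) (X : Type v) [MetricSpace X] [CompactSpace X] (ε : ℝ)
    (P : C(X, ℝ) → A.carrier → Prop) : Prop where
  lipOne : ∀ {f a}, P f a → LipOne f
  lt_one : ∀ {f a}, P f a → A.L a < 1
  exists_left : ∀ a, A.L a < 1 → ∃ f, P f a
  exists_right : ∀ f, LipOne f → ∃ a, P f a
  near : ∀ x, ∃ μ : State A.carrier, ∀ f a, P f a → |f x - μ.eval a| ≤ ε
  exists_point : ∀ (μ : State A.carrier) f a, P f a → ∃ x, μ.eval a ≤ f x + ε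

/-- Every 1-Lipschitz `f` is within `ε` of the image of some `b` in the open ball, and `b` is linked
to some `a`. Point evaluations are states of `B`, so each point is `2ε`-close to a state of `A`; the
third `ε` is room for a contradiction in the comparison of upper bounds. -/
theorem IsLink.exists_isBridge {A : CQMS.{u}} {B : CQMS.{v}} {ε : ℝ} (hε : 0 < ε)
    {P : A.carrier → B.carrier → Prop} (h : IsLink A B ε P) {X : Type w} [MetricSpace X]
    [CompactSpace X] {Ψ : B.carrier →ₗ[ℝ] C(X, ℝ)} (hΨ : IsModel B X Ψ) :
    ∃ Q, IsBridge A X (3 * ε) Q := by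
  refine ⟨fun f a => LipOne f ∧ ∃ b, P a b ∧ ∀ x, |Ψ b x - f x| ≤ ε, fun hf => hf.1, ?_, ?_, ?_,
    ?_, ?_⟩
  · rintro f a ⟨-, b, hab, -⟩
    exact h.left_lt hab
  · intro a ha
    obtain ⟨b, hab⟩ := h.exists_right a ha
    refine ⟨Ψ b, (hΨ.lipOne_iff _).2 (subset_closure ⟨b, (h.right_lt hab).le, rfl⟩), b, hab,
      fun x => ?_⟩
    rw [sub_self, abs_zero]
    exact hε.le
  · intro f hf
    have hf' := (hΨ.lipOne_iff f).1 hf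
    rw [closure_image_lt] at hf'
    obtain ⟨_, ⟨b, hb, rfl⟩, hd⟩ := Metric.mem_closure_iff.1 hf' ε hε
    obtain ⟨a, hab⟩ := h.exists_left b hb
    refine ⟨a, hf, b, hab, fun x => ?_⟩
    rw [dist_comm] at hd
    exact (ContinuousMap.dist_apply_le_dist (f := Ψ b) (g := f) x).trans hd.le
  · intro x
    obtain ⟨ν, hν⟩ := exists_state
      ({ toFun := fun b => Ψ b x
         map_add' := fun b c => by rw [map_add]; rfl
         map_smul' := fun r b => by rw [map_smul]; rfl } : B.carrier →ₗ[ℝ] ℝ)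
      (by change Ψ 1 x = 1; rw [hΨ.map_one]; rfl) fun b hb => (hΨ.nonneg_iff b).2 hb x
    have hν' : ∀ b, ν.eval b = Ψ b x := hν
    obtain ⟨μ, hμ⟩ := h.near_right ν
    refine ⟨μ, ?_⟩
    rintro f a ⟨-, b, hab, hbf⟩
    have h1 := abs_le.1 (hμ a b hab)
    have h2 := abs_le.1 (hbf x)
    rw [hν'] at h1
    rw [abs_le]
    constructor <;> linarith [h1.1, h1.2, h2.1, h2.2]
  · rintro μ f a ⟨-, b, hab, hbf⟩
    obtain ⟨ν, hν⟩ := h.near_left μ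
    by_contra! hlt
    -- If `f + 3ε < μ a` everywhere, then `b` is below `f + ε < μ a - 2ε ≤ ν b - ε` at every point,
    -- which the state `ν` refutes.
    have hb : b ≤ (ν.eval b - ε) • (1 : B.carrier) := by
      rw [hΨ.le_smul_one_iff]
      intro x
      have h1 := abs_le.1 (hν a b hab)
      linarith [(abs_le.1 (hbf x)).2, hlt x]
    linarith [ν.eval_le hb]

/-! ## Limits of ordinary metric spaces -/

section Limit

variable {A : CQMS.{u}} {X : ℕ → Type v} [∀ n, MetricSpace (X n)] [∀ n, CompactSpace (X n)]
  {ε : ℕ → ℝ} {P : ∀ n, C(X n, ℝ) → A.carrier → Prop}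

/-- The states of `A` that are limits, along an ultrafilter, of points of the spaces `X n`. -/
def limitStates (P : ∀ n, C(X n, ℝ) → A.carrier → Prop) : Set (State A.carrier) :=
  {μ | ∀ δ : ℝ, 0 < δ → ∀ᶠ n in (Filter.hyperfilter ℕ : Filter ℕ), ∃ x : X n, ∀ f a, P n f a →
    |f x - μ.eval a| ≤ δ}

/-- Compactness of the state space yields the weak-* ultralimit, and the Lip-norm property upgrades
the convergence to `rho`. -/
theorem exists_limit_state (μ : ℕ → State A.carrier) : ∃ ν : State A.carrier,
    (∀ a, Filter.Tendsto (fun n => (μ n).eval a) (Filter.hyperfilter ℕ : Filter ℕ)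
      (𝓝 (ν.eval a))) ∧
    ∀ δ : ℝ, 0 < δ → ∀ᶠ n in (Filter.hyperfilter ℕ : Filter ℕ),
      rho A.L (μ n) ν ≤ ENNReal.ofReal δ := by
  obtain ⟨ν, -, hν⟩ := isCompact_univ.ultrafilter_le_nhds
    ((Filter.hyperfilter ℕ).map μ) (by simp)
  have ht : Filter.Tendsto μ (Filter.hyperfilter ℕ : Filter ℕ) (𝓝 ν) := hν
  refine ⟨ν, fun a => ((State.continuous_eval a).tendsto ν).comp ht, fun δ hδ => ?_⟩
  filter_upwards [ht.eventually (A.isLipNorm.eventually_rho_lt ν (ENNReal.ofReal_pos.2 hδ))]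
    with n hn
  exact hn.le

theorem near_of_rho_le (hP : ∀ n, IsBridge A (X n) (ε n) (P n))
    {n : ℕ} {x : X n} {μ ν : State A.carrier} {δ η : ℝ} (hη : 0 ≤ η)
    (hμ : ∀ f a, P n f a → |f x - μ.eval a| ≤ δ) (h : rho A.L μ ν ≤ ENNReal.ofReal η) :
    ∀ f a, P n f a → |f x - ν.eval a| ≤ δ + η := fun f a hfa =>
  (abs_sub_le _ (μ.eval a) _).trans
    (add_le_add (hμ f a hfa) (abs_sub_le_of_rho_le hη h ((hP n).lt_one hfa).le))

theorem isClosed_limitStates (hP : ∀ n, IsBridge A (X n) (ε n) (P n)) :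
    IsClosed (limitStates P) := by
  refine isClosed_of_closure_subset fun μ hμ δ hδ => ?_
  obtain ⟨ν, hν, hνK⟩ := mem_closure_iff_nhds.1 hμ _
    (A.isLipNorm.eventually_rho_lt μ (ENNReal.ofReal_pos.2 (half_pos hδ)))
  filter_upwards [hνK _ (half_pos hδ)] with n hn
  obtain ⟨x, hx⟩ := hn
  refine ⟨x, ?_⟩
  have := near_of_rho_le hP (half_pos hδ).le hx (le_of_lt hν)
  rwa [add_halves] at this

/-- Both states are `1`-close to points `x`, `y` of a common `X n`, where corresponding functions
are 1-Lipschitz; so their distance is at most `2 + dist x y`. -/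
theorem rho_limitStates_lt_top (hP : ∀ n, IsBridge A (X n) (ε n) (P n))
    {μ ν : State A.carrier} (hμ : μ ∈ limitStates P)
    (hν : ν ∈ limitStates P) : rho A.L μ ν < ⊤ := by
  obtain ⟨n, ⟨x, hx⟩, ⟨y, hy⟩⟩ := ((hμ 1 one_pos).and (hν 1 one_pos)).exists
  refine lt_of_le_of_lt (rho_le_of_forall_lt (δ := 2 + dist x y) fun a ha => ?_)
    ENNReal.ofReal_lt_top
  obtain ⟨f, hf⟩ := (hP n).exists_left a ha
  have h1 := abs_le.1 (hx f a hf)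
  have h2 := abs_le.1 (hy f a hf)
  have h3 := abs_le.1 ((hP n).lipOne hf x y)
  rw [abs_le]
  constructor <;> linarith [h1.1, h1.2, h2.1, h2.2, h3.1, h3.2]

/-- There are enough limit states to bound every state. In each `X n` some point `x n` satisfies `μ
a ≤ f n (x n) + ε n`; a state near `x n` gives nearly the same value at `a`, and the ultralimit of
these states is a limit state whose value at `a` is at least `μ a`. -/
theorem eval_le_of_limitStates (hP : ∀ n, IsBridge A (X n) (ε n) (P n))
    (hε : Filter.Tendsto ε Filter.atTop (𝓝 0))
    {a : A.carrier} (ha : A.L a < 1) {r : ℝ}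
    (h : ∀ μ ∈ limitStates P, μ.eval a ≤ r) (μ : State A.carrier) : μ.eval a ≤ r := by
  choose f hf using fun n => (hP n).exists_left a ha
  choose x hx using fun n => (hP n).exists_point μ (f n) a (hf n)
  choose ν hν using fun n => (hP n).near (x n)
  obtain ⟨ξ, hξ, hξ'⟩ := exists_limit_state ν
  have hξK : ξ ∈ limitStates P := by
    intro δ hδ
    filter_upwards [(hε.eventually_lt_const (half_pos hδ)).filter_mono Nat.hyperfilter_le_atTop, hξ' _ (half_pos hδ)]
      with n hn hn'
    refine ⟨x n, fun g b hgb => ?_⟩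
    have := near_of_rho_le hP (half_pos hδ).le (hν n) hn' g b hgb
    linarith
  have hle : ∀ n, μ.eval a ≤ (ν n).eval a + 2 * ε n := fun n => by
    have := (abs_le.1 (hν n (f n) a (hf n))).2
    linarith [hx n]
  have hlim : Filter.Tendsto (fun n => (ν n).eval a + 2 * ε n)
      (Filter.hyperfilter ℕ : Filter ℕ) (𝓝 (ξ.eval a + 2 * 0)) :=
    (hξ a).add ((hε.mono_left Nat.hyperfilter_le_atTop).const_mul 2)
  rw [mul_zero, add_zero] at hlim
  exact (ge_of_tendsto hlim (Filter.Eventually.of_forall hle)).trans (h ξ hξK)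

theorem nonneg_of_limitStates (hP : ∀ n, IsBridge A (X n) (ε n) (P n))
    (hε : Filter.Tendsto ε Filter.atTop (𝓝 0)) {a : A.carrier}
    (h : ∀ μ ∈ limitStates P, 0 ≤ μ.eval a) :
    0 ≤ a := by
  refine nonneg_of_forall_state fun μ => ?_
  have h0 : 0 < (A.L a + 1)⁻¹ := inv_pos.2 (by linarith [apply_nonneg A.L a])
  have hL : A.L ((-(A.L a + 1)⁻¹) • a) < 1 := by
    rw [map_smul_eq_mul, norm_neg, Real.norm_of_nonneg h0.le,
      inv_mul_lt_iff₀ (inv_pos.1 h0)]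
    linarith
  have := eval_le_of_limitStates hP hε hL (r := 0) (fun ν hν => by
    rw [State.eval_smul]
    exact mul_nonpos_of_nonpos_of_nonneg (neg_nonpos.2 h0.le) (h ν hν)) μ
  rw [State.eval_smul] at this
  nlinarith

/-- By definition each limit state has its own set of good indices; compactness makes the choice
uniform. Counterexamples `μ n` would accumulate at some `ξ`. One `μ m` near `ξ` is itself
`δ/4`-close to points of `X n`, and the path from `μ m` through `ξ` to `μ n` adds only `δ/4` twice.
-/
theorem eventually_forall_limitStates (hP : ∀ n, IsBridge A (X n) (ε n) (P n))
    {δ : ℝ} (hδ : 0 < δ) :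
    ∀ᶠ n in (Filter.hyperfilter ℕ : Filter ℕ), ∀ μ ∈ limitStates P, ∃ x : X n, ∀ f a, P n f a →
      |f x - μ.eval a| ≤ δ := by
  by_contra hn
  -- For an ultrafilter, failing to hold eventually means failing eventually, so counterexamples
  -- exist for almost every index.
  rw [← Ultrafilter.eventually_not] at hn
  push Not at hn
  obtain ⟨n₀, μ₀, -, -⟩ := hn.exists
  -- A total choice is needed: `μ₀` is a filler at indices without a counterexample.
  have hch : ∀ n, ∃ μ : State A.carrier, (∃ ν ∈ limitStates P, ∀ x : X n, ∃ f a, P n f a ∧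
      δ < |f x - ν.eval a|) → μ ∈ limitStates P ∧ ∀ x : X n, ∃ f a, P n f a ∧
      δ < |f x - μ.eval a| := fun n => by
    by_cases h : ∃ ν ∈ limitStates P, ∀ x : X n, ∃ f a, P n f a ∧ δ < |f x - ν.eval a|
    · obtain ⟨ν, hν⟩ := h
      exact ⟨ν, fun _ => hν⟩
    · exact ⟨μ₀, fun h' => absurd h' h⟩
  choose μ hμ using hch
  obtain ⟨ξ, -, hξ⟩ := exists_limit_state μ
  have hmem : ∃ᶠ n in (Filter.hyperfilter ℕ : Filter ℕ),
      μ n ∈ limitStates P ∧ rho A.L (μ n) ξ ≤ ENNReal.ofReal (δ / 4) :=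
    ((hn.mono fun n h => (hμ n h).1).and (hξ _ (by positivity))).frequently
  obtain ⟨m, hm, hmξ⟩ := hmem.exists
  obtain ⟨n, h1, h2, h3⟩ := (hn.and ((hξ _ (show 0 < δ / 4 by positivity)).and
    (hm (δ / 4) (by positivity)))).exists
  obtain ⟨x, hx⟩ := h3
  have hx' := near_of_rho_le hP (by positivity) hx hmξ
  have hx'' := near_of_rho_le hP (by positivity) hx' ((rho_comm A.L ξ (μ n)).trans_le h2)
  obtain ⟨f, a, hfa, hlt⟩ := (hμ n h1).2 x
  linarith [hx'' f a hfa]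

/-- Here the commutativity of the approximating spaces enters. The elements are carried to one `X
n`, their maximum is taken there among 1-Lipschitz functions, and the result is carried back.
Uniform closeness is essential, since one `c` must serve all limit states. -/
theorem exists_max_limitStates (hP : ∀ n, IsBridge A (X n) (ε n) (P n))
    {a b : A.carrier} (ha : A.L a < 1) (hb : A.L b < 1) {δ : ℝ}
    (hδ : 0 < δ) : ∃ c, A.L c < 1 ∧ ∀ μ ∈ limitStates P,
      |μ.eval c - max (μ.eval a) (μ.eval b)| ≤ δ := by
  obtain ⟨n, hn⟩ := (eventually_forall_limitStates hP (half_pos hδ)).exists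
  obtain ⟨f, hf⟩ := (hP n).exists_left a ha
  obtain ⟨g, hg⟩ := (hP n).exists_left b hb
  have hfg : LipOne (f ⊔ g) := fun x y =>
    (abs_max_sub_max_le_max (f x) (g x) (f y) (g y)).trans
      (max_le ((hP n).lipOne hf x y) ((hP n).lipOne hg x y))
  obtain ⟨c, hc⟩ := (hP n).exists_right _ hfg
  refine ⟨c, (hP n).lt_one hc, fun μ hμ => ?_⟩
  obtain ⟨x, hx⟩ := hn μ hμ
  have h1 := hx _ c hc
  have h2 : |max (f x) (g x) - max (μ.eval a) (μ.eval b)| ≤ δ / 2 :=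
    (abs_max_sub_max_le_max _ _ _ _).trans (max_le (hx f a hf) (hx g b hg))
  have h3 : (f ⊔ g) x = max (f x) (g x) := rfl
  rw [h3, abs_sub_comm] at h1
  have := (abs_sub_le (μ.eval c) (max (f x) (g x)) (max (μ.eval a) (μ.eval b))).trans
    (add_le_add h1 h2)
  rwa [add_halves] at this

end Limit

/-! ### The limit space as a compact metric space, and its models -/

section Limit

variable {A : CQMS.{u}} {X : ℕ → Type v} [∀ n, MetricSpace (X n)] [∀ n, CompactSpace (X n)]
  {ε : ℕ → ℝ} {P : ∀ n, C(X n, ℝ) → A.carrier → Prop}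

/-- The limit states form a compact metric space for `ρ_L`. -/
theorem exists_metricSpace_limitStates (hP : ∀ n, IsBridge A (X n) (ε n) (P n)) :
    ∃ (Y : Type u) (_ : MetricSpace Y) (_ : CompactSpace Y) (ι : Y → State A.carrier),
      (∀ x y, rho A.L (ι x) (ι y) = edist x y) ∧ Set.range ι = limitStates P := by
  -- Weak-* compactness becomes compactness for `rho` because the two topologies agree.
  have hcomp : @IsCompact _ (stateEMetric A.L).toUniformSpace.toTopologicalSpace
      (limitStates P) := by
    rw [A.isLipNorm.topology_eq]
    exact (isClosed_limitStates hP).isCompact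
  let E : PseudoEMetricSpace (State A.carrier) := stateEMetric A.L
  let E' : EMetricSpace (limitStates P) :=
    { PseudoEMetricSpace.induced Subtype.val E with
      eq_of_edist_eq_zero := fun h => Subtype.ext (eq_of_rho_eq_zero h) }
  have hfin : ∀ x y : limitStates P, edist x y ≠ ⊤ := fun x y =>
    (rho_limitStates_lt_top hP x.2 y.2).ne
  refine ⟨limitStates P, EMetricSpace.toMetricSpace hfin, ?_, Subtype.val, fun x y => rfl,
    Subtype.range_coe⟩
  exact (@isCompact_iff_compactSpace _ E.toUniformSpace.toTopologicalSpace _).1 hcomp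

/-- A limit of ordinary metric spaces has a model over any metric copy of its limit states. -/
theorem exists_isModel_of_range_eq (hP : ∀ n, IsBridge A (X n) (ε n) (P n))
    (hε : Filter.Tendsto ε Filter.atTop (𝓝 0)) {Y : Type w} [MetricSpace Y] [CompactSpace Y]
    {ι : Y → State A.carrier} (hι : ∀ x y, rho A.L (ι x) (ι y) = edist x y)
    (hr : Set.range ι = limitStates P) : ∃ Ψ : A.carrier →ₗ[ℝ] C(Y, ℝ), IsModel A Y Ψ := by
  refine ⟨_, isModel_evalMap A ι hι (fun a ha => nonneg_of_limitStates hP hε ?_)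
    fun a b ha hb δ hδ => ?_⟩
  · rw [← hr]
    rintro _ ⟨y, rfl⟩
    exact ha y
  · obtain ⟨c, hc, h⟩ := exists_max_limitStates hP ha hb hδ
    exact ⟨c, hc, fun y => h _ (hr.le ⟨y, rfl⟩)⟩

theorem exists_isModel (hP : ∀ n, IsBridge A (X n) (ε n) (P n))
    (hε : Filter.Tendsto ε Filter.atTop (𝓝 0)) :
    ∃ (Y : Type u) (_ : MetricSpace Y) (_ : CompactSpace Y) (Ψ : A.carrier →ₗ[ℝ] C(Y, ℝ)),
      IsModel A Y Ψ := by
  obtain ⟨Y, _, _, ι, hι, hr⟩ := exists_metricSpace_limitStates hP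
  exact ⟨Y, _, _, exists_isModel_of_range_eq hP hε hι hr⟩

/-- The Kuratowski embedding puts the limit space isometrically into bounded real sequences, so a
metric copy lives in `Type` whatever the universe of `A`. -/
theorem exists_isModel_type_zero (hP : ∀ n, IsBridge A (X n) (ε n) (P n))
    (hε : Filter.Tendsto ε Filter.atTop (𝓝 0)) :
    ∃ (Y : Type) (_ : MetricSpace Y) (_ : CompactSpace Y) (Ψ : A.carrier →ₗ[ℝ] C(Y, ℝ)),
      IsModel A Y Ψ := by
  obtain ⟨Y, _, _, ι, hι, hr⟩ := exists_metricSpace_limitStates hP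
  obtain ⟨f, hf⟩ := KuratowskiEmbedding.exists_isometric_embedding Y
  have hcomp : CompactSpace (Set.range f) :=
    isCompact_iff_compactSpace.1 (isCompact_range hf.continuous)
  let e : Y ≃ᵢ Set.range f := hf.isometryEquivOnRange
  refine ⟨Set.range f, inferInstance, hcomp,
    exists_isModel_of_range_eq (ι := ι ∘ e.symm) hP hε (fun x y => ?_) ?_⟩
  · exact (hι _ _).trans (e.symm.isometry.edist_eq x y)
  · rw [e.symm.surjective.range_comp, hr]

end Limit

/-! ### Conclusion: from small quantum distance to the theorem -/

theorem exists_isBridge_of_distq_lt {A : CQMS.{u}} {B : CQMS.{v}} {X : Type w} [MetricSpace X]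
    [CompactSpace X] {Ψ : B.carrier →ₗ[ℝ] C(X, ℝ)} (hΨ : IsModel B X Ψ) {ε : ℝ} (hε : 0 < ε)
    (h : distq A B < ENNReal.ofReal ε ∨ distq B A < ENNReal.ofReal ε) :
    ∃ Q, IsBridge A X (3 * ε) Q := by
  rcases h with h | h
  · obtain ⟨P, hP⟩ := exists_isLink_of_distq_lt hε.le h
    exact hP.exists_isBridge hε hΨ
  · obtain ⟨P, hP⟩ := exists_isLink_of_distq_lt hε.le h
    exact hP.symm.exists_isBridge hε hΨ

theorem tendsto_three_mul_one_div :
    Filter.Tendsto (fun n : ℕ => 3 * (1 / ((n : ℝ) + 1))) Filter.atTop (𝓝 0) := by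
  have := (tendsto_one_div_add_atTop_nhds_zero_nat (𝕜 := ℝ)).const_mul 3
  rwa [mul_zero] at this

end QGH

theorem theorem13p16 :
    -- the classes of ordinary compact metric spaces form a closed subset of `QSpace`
    IsClosed {q : QGH.QSpace.{u} | ∃ (X : Type u) (_ : MetricSpace X) (_ : CompactSpace X),
      q = QGH.QSpace.mk (QGH.CQMS.ofMetric X)} ∧
    -- limits of sequences of ordinary compact metric spaces
    ∀ (X : ℕ → Type v) [∀ n, MetricSpace (X n)] [∀ n, CompactSpace (X n)] (A : QGH.CQMS.{w}),
      Filter.Tendsto (fun n => QGH.distq (QGH.CQMS.ofMetric (X n)) A) Filter.atTop (𝓝 0) →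
      ∃ (Y : Type) (_ : MetricSpace Y) (_ : CompactSpace Y)
        (Φ : QGH.OrderUnitIso A.Completion C(Y, ℝ)),
        (∀ x : A.Completion, x ∈ A.closureSpace ↔ Φ.toLinearEquiv x ∈ QGH.lipSubmodule Y) ∧
        ∀ x ∈ A.closureSpace, A.closureL x = QGH.lipConst (Φ.toLinearEquiv x) := by
  have hpos : ∀ n : ℕ, (0 : ℝ) < 1 / ((n : ℝ) + 1) := fun n => Nat.one_div_pos_of_nat
  constructor
  · rw [← isOpen_compl_iff]
    intro A hA
    by_contra! hcon
    have hX : ∀ n : ℕ, ∃ (X : Type u) (_ : MetricSpace X) (_ : CompactSpace X),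
        ∃ Q, QGH.IsBridge A X (3 * (1 / ((n : ℝ) + 1))) Q := by
      intro n
      obtain ⟨B, hAB, hB⟩ := hcon _ (ENNReal.ofReal_pos.2 (hpos n))
      obtain ⟨X, _, _, hBX⟩ := not_not.1 hB
      -- The nearby `B` is only isometric to an ordinary space. Moving the model to `B` avoids both
      -- a triangle inequality and isometry invariance for `distq`.
      obtain ⟨Ψ, hΨ⟩ := (QGH.isModel_ofMetric X).of_isometric (Quotient.exact hBX)
      exact ⟨X, _, _, QGH.exists_isBridge_of_distq_lt hΨ (hpos n) (Or.inl hAB)⟩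
    choose X i₁ i₂ Q hQ using hX
    obtain ⟨Y, _, _, Ψ, hΨ⟩ := QGH.exists_isModel hQ QGH.tendsto_three_mul_one_div
    exact hA ⟨Y, _, _, Quotient.sound (hΨ.isometric (QGH.isModel_ofMetric Y))⟩
  · intro X _ _ A hXA
    -- Passing to indices `n k` with distance below `1 / (k + 1)` gives explicit tolerances; the
    -- indices need not increase.
    have hk : ∀ k : ℕ, ∃ n, ∃ Q, QGH.IsBridge A (X n) (3 * (1 / ((k : ℝ) + 1))) Q := by
      intro k
      obtain ⟨n, hn⟩ :=
        (hXA.eventually_lt_const (ENNReal.ofReal_pos.2 (hpos k))).exists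
      exact ⟨n, QGH.exists_isBridge_of_distq_lt (QGH.isModel_ofMetric (X n)) (hpos k)
        (Or.inr hn)⟩
    choose n Q hQ using hk
    obtain ⟨Y, _, _, Ψ, hΨ⟩ := QGH.exists_isModel_type_zero hQ QGH.tendsto_three_mul_one_div
    obtain ⟨Φ, -, h⟩ := hΨ.exists_iso
    exact ⟨Y, ‹_›, ‹_›, Φ, h⟩
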